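/- Consider a charged three-body system: masses $m_1,m_2,m_3>0$, real coefficients $\gamma_{ij}=\gamma_{ji}$, positions $q=(q_1,q_2,q_3)\in(\mathbb{R}^3)^3$ with $q_i\ne q_j$ for $i\neq j$, momenta $p=(p_1,p_2,p_3)\in(\mathbb{R}^3)^3$, potential $V(q)=-\sum_{i<j}\gamma_{ij}/\|q_i-q_j\|$ and Hamiltonian $H(q,p)=\sum_i\|p_i\|^2/(2m_i)+V(q)$. Let $L=\sum_i q_i\times p_i$, $P=\sum_i p_i$, $Q=\sum_i m_iq_i/\sum_i m_i$, and let $\mathcal F=(H,L,P,Q)$ be the integral map, with values in $\mathbb{R}^{10}$. A configuration $q$ is a central configuration if there is $\lambda\in\mathbb{R}$ with $\partial V/\partial q_i=\lambda m_i(q_i-Q)$ for all $i$. A critical point of $\mathcal F$ is a point $(q,p)$ with $P=0$, $Q=0$ at which the derivative of $\mathcal F$ has rank less than $10$. It is associated to the central configuration $q$ if it is a relative equilibrium, that is, $(q,p)$ is not an equilibrium and the Hamiltonian vector field of $H$ agrees at $(q,p)$ with that of $\langle\xi,L\rangle$ for some $\xi\in\mathbb{R}^3$. Two points of phase space are similar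 if they differ by a rotation and a translation of $\mathbb{R}^3$ and a dilation $(q,p)\mapsto(\mu^2q,\mu^{-1}p)$, $\mu\in\mathbb{R}\setminus\{0\}$ (together with $t\mapsto\mu^3t$ this preserves the equations of motion; $\mu=-1$ is time reversal). Then, up to similarity: 1. For all values of the masses and of the $\gamma_{ij}$ there are zero, one, two or three critical points of $\mathcal F$ associated to collinear central configurations. Each of these four numbers occurs for suitable values of the parameters, and even for values for which body $3$ lies strictly between bodies $1$ and $2$ in all these configurations (so that they do not differ merely by a permutation of the bodies). 2. For all values of the masses and of the $\gamma_{ij}$ there is at most one critical point of $\mathcal F$ associated to a non-collinear central configuration. -/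

import Mathlib

open scoped RealInnerProductSpace

/-- Physical space `ℝ³` with its Euclidean structure. -/
abbrev Space3 : Type := EuclideanSpace ℝ (Fin 3)

/-- Position vectors `q = (q₁, …, q_N)`. -/
abbrev Config (N : ℕ) : Type := Fin N → Space3

/-- Pairs `(q, p)` of positions and momenta. -/
abbrev Phase (N : ℕ) : Type := Config N × Config N

/-- The configuration space: the complement of the collision set. -/
def configSpace (N : ℕ) : Set (Config N) :=
  {q | ∀ i j, i ≠ j → q i ≠ q j}

/-- The phase space: the cotangent bundle of the configuration space. -/
def phaseSpace (N : ℕ) : Set (Phase N) :=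
  {x | x.1 ∈ configSpace N}

/-- The vector product on `ℝ³`. -/
noncomputable def cross3 (x y : Space3) : Space3 :=
  WithLp.toLp 2 (crossProduct x.ofLp y.ofLp)

/-- The partial gradient of a function of `N` vectors with respect to the `i`-th vector. -/
noncomputable def partialGrad {N : ℕ} (f : Config N → ℝ) (q : Config N) (i : Fin N) : Space3 :=
  gradient (fun v : Space3 => f (Function.update q i v)) (q i)

/-- The Hamiltonian vector field `(∂G/∂p, -∂G/∂q)` of a function `G` of `(q, p)`. -/
noncomputable def hamiltonianField {N : ℕ} (G : Phase N → ℝ) (x : Phase N) : Phase N :=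
  (fun i => partialGrad (fun p => G (x.1, p)) x.2 i,
   fun i => -partialGrad (fun q => G (q, x.2)) x.1 i)

/-- The total angular momentum `L = ∑ qᵢ × pᵢ`. -/
noncomputable def angularMomentum {N : ℕ} (x : Phase N) : Space3 :=
  ∑ i, cross3 (x.1 i) (x.2 i)

/-- The total momentum `P = ∑ pᵢ`. -/
noncomputable def totalMomentum {N : ℕ} (x : Phase N) : Space3 :=
  ∑ i, x.2 i

/-- The parameters of a charged `N`-body system: the masses and the symmetric real coefficients
of the potential. -/
structure ChargedSystem (N : ℕ) where
  mass : Fin N → ℝ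
  mass_pos : ∀ i, 0 < mass i
  γ : Fin N → Fin N → ℝ
  γ_symm : ∀ i j, γ i j = γ j i

namespace ChargedSystem

variable {N : ℕ} (S : ChargedSystem N)

/-- The potential `V(q) = ∑_{i<j} -γᵢⱼ / ‖qᵢ - qⱼ‖`. -/
noncomputable def potential (q : Config N) : ℝ :=
  ∑ i, ∑ j ∈ Finset.Ioi i, -(S.γ i j / ‖q i - q j‖)

/-- The Hamiltonian `H = T + V`. -/
noncomputable def hamiltonian (x : Phase N) : ℝ :=
  (∑ i, 1 / (2 * S.mass i) * ‖x.2 i‖ ^ 2) + S.potential x.1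

/-- The center of mass `Q`. -/
noncomputable def centerOfMass (q : Config N) : Space3 :=
  (∑ i, S.mass i)⁻¹ • ∑ i, S.mass i • q i

/-- The integral map `(H, L, P, Q)`, with values in a ten-dimensional space. -/
noncomputable def integralMap (x : Phase N) : ℝ × Space3 × Space3 × Space3 :=
  (S.hamiltonian x, angularMomentum x, totalMomentum x, S.centerOfMass x.1)

/-- Critical points of the integral map: the derivative does not have full rank `10`. The total
momentum and the center of mass are normalized to zero. -/
def IsCriticalPoint (x : Phase N) : Prop :=
  x ∈ phaseSpace N ∧ totalMomentum x = 0 ∧ S.centerOfMass x.1 = 0 ∧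
    ¬ Function.Surjective (fderiv ℝ S.integralMap x)

/-- Equilibrium points of the Hamiltonian vector field. -/
def IsEquilibrium (x : Phase N) : Prop :=
  x ∈ phaseSpace N ∧ hamiltonianField S.hamiltonian x = 0

/-- Relative equilibria with respect to rotations: points which are not equilibria, at which the
Hamiltonian vector field agrees with that of `⟪ξ, L⟫`, the generator of a one-parameter group of
rotations, for some `ξ`. -/
def IsRelativeEquilibrium (x : Phase N) : Prop :=
  x ∈ phaseSpace N ∧ ¬ S.IsEquilibrium x ∧
    ∃ ξ : Space3, hamiltonianField S.hamiltonian x =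
      hamiltonianField (fun y : Phase N => ⟪ξ, angularMomentum y⟫) x

/-- Central configurations (with a real multiplier `lam`). -/
def IsCentralConfiguration (q : Config N) : Prop :=
  q ∈ configSpace N ∧ ∃ lam : ℝ, ∀ i,
    partialGrad S.potential q i = (lam * S.mass i) • (q i - S.centerOfMass q)

/-- The critical points of the integral map that are associated to collinear central
configurations: the relative equilibria that project to such a configuration. -/
def collinearCriticalPoints : Set (Phase N) :=
  {x | S.IsCriticalPoint x ∧ S.IsRelativeEquilibrium x ∧ S.IsCentralConfiguration x.1 ∧
    Collinear ℝ (Set.range x.1)}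

/-- The critical points of the integral map that are associated to non-collinear central
configurations. -/
def nonCollinearCriticalPoints : Set (Phase N) :=
  {x | S.IsCriticalPoint x ∧ S.IsRelativeEquilibrium x ∧ S.IsCentralConfiguration x.1 ∧
    ¬ Collinear ℝ (Set.range x.1)}

end ChargedSystem

/-- Similarity of points `(q, p)`: they differ by a rotation `R`, a translation `a` and a dilation
`(q, p) ↦ (μ² q, μ⁻¹ p)` with `μ ≠ 0` (accompanied by `t ↦ μ³ t` on time, so that the equations of
motion are preserved; `μ = -1` is time reversal). -/
def IsSimilar {N : ℕ} (x y : Phase N) : Prop :=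
  ∃ (R : Space3 ≃ₗᵢ[ℝ] Space3) (a : Space3) (μ : ℝ),
    LinearMap.det (R.toLinearEquiv : Space3 →ₗ[ℝ] Space3) = 1 ∧ μ ≠ 0 ∧
    (∀ i, y.1 i = μ ^ 2 • R (x.1 i) + a) ∧ ∀ i, y.2 i = μ⁻¹ • R (x.2 i)

theorem IsSimilar.refl' {N : ℕ} (x : Phase N) : IsSimilar x x := by
  refine ⟨LinearIsometryEquiv.refl ℝ Space3, 0, 1, ?_, one_ne_zero, ?_, ?_⟩
  · exact LinearMap.det_id
  · intro i; simp
  · intro i; simp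

theorem IsSimilar.symm' {N : ℕ} {x y : Phase N} (h : IsSimilar x y) : IsSimilar y x := by
  obtain ⟨R, a, μ, hR, hμ, hq, hp⟩ := h
  refine ⟨R.symm, -((μ⁻¹) ^ 2 • R.symm a), μ⁻¹, ?_, inv_ne_zero hμ, ?_, ?_⟩
  · have h1 := LinearEquiv.det_symm_mul_det R.toLinearEquiv
    rw [hR, mul_one] at h1
    exact h1
  · intro i
    rw [hq i]
    simp only [map_add, map_smul, LinearIsometryEquiv.symm_apply_apply, smul_add, smul_smul]
    rw [← mul_pow, inv_mul_cancel₀ hμ]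
    simp
  · intro i
    rw [hp i]
    simp [smul_smul, hμ]

theorem IsSimilar.trans' {N : ℕ} {x y z : Phase N} (h : IsSimilar x y) (h' : IsSimilar y z) :
    IsSimilar x z := by
  obtain ⟨R, a, μ, hR, hμ, hq, hp⟩ := h
  obtain ⟨R', a', μ', hR', hμ', hq', hp'⟩ := h'
  refine ⟨R.trans R', μ' ^ 2 • R' a + a', μ' * μ, ?_, mul_ne_zero hμ' hμ, ?_, ?_⟩
  · have h1 := LinearMap.det_comp (R'.toLinearEquiv : Space3 →ₗ[ℝ] Space3)
      (R.toLinearEquiv : Space3 →ₗ[ℝ] Space3)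
    rw [hR, hR', mul_one] at h1
    exact h1
  · intro i
    rw [hq' i, hq i]
    simp only [map_add, map_smul, LinearIsometryEquiv.trans_apply, smul_add, smul_smul, mul_pow]
    abel
  · intro i
    rw [hp' i, hp i]
    simp [smul_smul, mul_comm]

/-- Similarity as an equivalence relation. -/
def similarity (N : ℕ) : Setoid (Phase N) where
  r := IsSimilar
  iseqv := ⟨IsSimilar.refl', IsSimilar.symm', IsSimilar.trans'⟩

/-- The number (possibly infinite) of points of a set, up to similarity. -/
noncomputable def numUpToSimilarity {N : ℕ} (A : Set (Phase N)) : ℕ∞ :=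
  ((Quotient.mk (similarity N)) '' A).encard

/-! ### Counting zeros -/

/-! The critical points in question are uniform rotations. Equality of the Hamiltonian fields of $H$
and $\langle\xi,L\rangle$ gives $p_i=m_i\,\xi\times q_i$ and $\partial V/\partial
q_i=-m_i\,\xi\times(\xi\times q_i)$. For a central configuration that is not at equilibrium this
forces $q_i\perp\xi\neq0$ and multiplier $|\xi|^2>0$ (`exists_isRotating`). Conversely such a
rotation makes $dH=d\langle\xi,L\rangle$, so the rank drops automatically. The mutual distances up
to scale determine the rotation up to similarity (`IsRotating.isSimilar`): Kepler's law fixes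
$|\xi|$, and time reversal absorbs its direction. So shapes of central configurations with positive
multiplier are to be counted.

With the center of mass at $0$ and multiplier $\kappa M$, the equations read $\sum_j
w_{ij}(q_i-q_j)=0$, where $w_{ij}=\gamma_{ij}/r_{ij}^3-\kappa m_im_j$. Off a line the two
differences are independent, so all $w_{ij}$ vanish and the distances are determined up to scale.

On a line, for each choice of the middle body, three linear conditions on $(\kappa,\tau)$ remain,
where $\tau$ is the weight of the first pair. Their compatibility is Euler's quintic in the ratio
$\rho$ of the adjacent distances. The signs of the coefficients bound its positive zeros by three,
two or one, in the manner of Descartes' rule. The condition $\kappa>0$ excludes some orders and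
restricts the parameters in others, and together these facts bound the sum over the three orders by
three (`encard_collinearShape_sum_le`). Explicit quintics with rational roots realize all four
numbers. -/

theorem Set.exists_strictMono_of_lt_encard {s : Set ℝ} {n : ℕ} (h : (n : ℕ∞) < s.encard) :
    ∃ f : Fin (n + 1) → ℝ, StrictMono f ∧ ∀ i, f i ∈ s := by
  have h1 : ((n + 1 : ℕ) : ℕ∞) ≤ s.encard := by
    push_cast
    exact Order.add_one_le_of_lt h
  obtain ⟨t, hts, ht⟩ := Set.exists_subset_encard_eq h1
  have hfin : t.Finite := Set.finite_of_encard_eq_coe ht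
  have hcard : hfin.toFinset.card = n + 1 := by
    have := hfin.encard_eq_coe_toFinset_card
    rw [ht] at this
    exact_mod_cast this.symm
  refine ⟨hfin.toFinset.orderEmbOfFin hcard, (hfin.toFinset.orderEmbOfFin hcard).strictMono,
    fun i => hts ?_⟩
  exact hfin.mem_toFinset.1 (hfin.toFinset.orderEmbOfFin_mem hcard i)

theorem StrictMonoOn.encard_zeros_le_one {s : Set ℝ} {f : ℝ → ℝ} (hf : StrictMonoOn f s) :
    {x ∈ s | f x = 0}.encard ≤ 1 := by
  rw [Set.encard_le_one_iff]
  rintro x y ⟨hx, hx0⟩ ⟨hy, hy0⟩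
  exact hf.injOn hx hy (hx0.trans hy0.symm)

/-- Three zeros would give two adjacent slopes both equal to $0$, but slopes strictly increase. -/
theorem StrictConvexOn.encard_zeros_le_two {s : Set ℝ} {f : ℝ → ℝ} (hf : StrictConvexOn ℝ s f) :
    {x ∈ s | f x = 0}.encard ≤ 2 := by
  by_contra! h
  obtain ⟨u, hu, hus⟩ := Set.exists_strictMono_of_lt_encard (n := 2) h
  have h01 : u 0 < u 1 := hu (by decide)
  have h12 : u 1 < u 2 := hu (by decide)
  have := hf.slope_strict_mono_adjacent (hus 0).1 (hus 2).1 h01 h12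
  rw [(hus 0).2, (hus 1).2, (hus 2).2] at this
  simp at this

/-- Rolle's theorem, used twice: four zeros of `f` give three of `f'` and two of `f''`. -/
theorem encard_zeros_le_three_of_strictMonoOn {f f' f'' : ℝ → ℝ}
    (hf : ∀ x, 0 < x → HasDerivAt f (f' x) x) (hf' : ∀ x, 0 < x → HasDerivAt f' (f'' x) x)
    (hmono : StrictMonoOn f'' (Set.Ioi 0)) : {x ∈ Set.Ioi (0 : ℝ) | f x = 0}.encard ≤ 3 := by
  by_contra! h
  obtain ⟨u, hu, hus⟩ := Set.exists_strictMono_of_lt_encard (n := 3) h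
  have rolle : ∀ (g g' : ℝ → ℝ), (∀ x, 0 < x → HasDerivAt g (g' x) x) → ∀ x y, 0 < x → x < y →
      g x = 0 → g y = 0 → ∃ z, x < z ∧ z < y ∧ g' z = 0 := by
    intro g g' hg x y hx hxy h1 h2
    obtain ⟨z, hz, hz'⟩ := exists_hasDerivAt_eq_zero (f := g) (f' := g') hxy
      (fun w hw => (hg w (hx.trans_le hw.1)).continuousAt.continuousWithinAt) (h1.trans h2.symm)
      (fun w hw => hg w (hx.trans hw.1))
    exact ⟨z, hz.1, hz.2, hz'⟩
  have hpos : ∀ i, 0 < u i := fun i => (hus i).1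
  obtain ⟨v0, ha0, hb0, hv0⟩ := rolle f f' hf (u 0) (u 1) (hpos 0) (hu (by decide))
    (hus 0).2 (hus 1).2
  obtain ⟨v1, ha1, hb1, hv1⟩ := rolle f f' hf (u 1) (u 2) (hpos 1) (hu (by decide))
    (hus 1).2 (hus 2).2
  obtain ⟨v2, ha2, hb2, hv2⟩ := rolle f f' hf (u 2) (u 3) (hpos 2) (hu (by decide))
    (hus 2).2 (hus 3).2
  obtain ⟨w0, hc0, hd0, hw0⟩ := rolle f' f'' hf' v0 v1 ((hpos 0).trans ha0) (hb0.trans ha1) hv0 hv1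
  obtain ⟨w1, hc1, hd1, hw1⟩ := rolle f' f'' hf' v1 v2 ((hpos 1).trans ha1) (hb1.trans ha2) hv1 hv2
  have h0 : 0 < w0 := ((hpos 0).trans ha0).trans hc0
  have := hmono (Set.mem_Ioi.2 h0) (Set.mem_Ioi.2 (h0.trans (hd0.trans hc1))) (hd0.trans hc1)
  rw [hw0, hw1] at this
  exact lt_irrefl _ this

/-! ### Positive zeros of quintic polynomials -/

/-- A real quintic polynomial as a function. -/
def quintic (c₅ c₄ c₃ c₂ c₁ c₀ x : ℝ) : ℝ :=
  c₅ * x ^ 5 + c₄ * x ^ 4 + c₃ * x ^ 3 + c₂ * x ^ 2 + c₁ * x + c₀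

/-- The positive zeros of a real quintic polynomial. -/
def quinticPosZeros (c₅ c₄ c₃ c₂ c₁ c₀ : ℝ) : Set ℝ :=
  {x ∈ Set.Ioi (0 : ℝ) | quintic c₅ c₄ c₃ c₂ c₁ c₀ x = 0}

theorem quinticPosZeros_neg (c₅ c₄ c₃ c₂ c₁ c₀ : ℝ) :
    quinticPosZeros (-c₅) (-c₄) (-c₃) (-c₂) (-c₁) (-c₀) = quinticPosZeros c₅ c₄ c₃ c₂ c₁ c₀ := by
  ext x
  simp only [quinticPosZeros, quintic, Set.mem_ofPred_eq]
  refine and_congr_right fun _ => ?_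
  rw [← neg_eq_zero]
  ring_nf

/-- Dividing by a power of $x$ keeps the positive zeros and, with the exponent placed at a sign
change, makes the quotient or its second derivative monotone, or the quotient convex. -/
theorem quinticPosZeros_eq_of_div {c₅ c₄ c₃ c₂ c₁ c₀ : ℝ} {f : ℝ → ℝ} (k : ℕ)
    (h : ∀ x, 0 < x → f x * x ^ k = quintic c₅ c₄ c₃ c₂ c₁ c₀ x) :
    quinticPosZeros c₅ c₄ c₃ c₂ c₁ c₀ = {x ∈ Set.Ioi (0 : ℝ) | f x = 0} := by
  ext x
  simp only [quinticPosZeros, Set.mem_ofPred_eq]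
  refine and_congr_right fun hx => ?_
  have hx : 0 < x := hx
  rw [← h x hx, mul_eq_zero, or_iff_left (pow_pos hx k).ne']

theorem encard_quinticPosZeros_le_three {c₅ c₄ c₃ c₂ c₁ c₀ : ℝ} (h5 : 0 ≤ c₅)
    (h1 : c₁ ≤ 0) (h0 : c₀ ≤ 0) (h : 0 < c₅ ∨ c₀ < 0) :
    (quinticPosZeros c₅ c₄ c₃ c₂ c₁ c₀).encard ≤ 3 := by
  rw [quinticPosZeros_eq_of_div (f := fun x => c₅ * x ^ 3 + c₄ * x ^ 2 + c₃ * x + c₂ + c₁ * x⁻¹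
    + c₀ * (x ^ 2)⁻¹) 2 (by intro x hx; simp only [quintic]; field_simp)]
  refine encard_zeros_le_three_of_strictMonoOn
    (f' := fun x => 3 * c₅ * x ^ 2 + 2 * c₄ * x + c₃ - c₁ * (x ^ 2)⁻¹
      - 2 * c₀ * (x ^ 3)⁻¹)
    (f'' := fun x => 6 * c₅ * x + 2 * c₄ + 2 * c₁ / x ^ 3 + 6 * c₀ / x ^ 4) ?_ ?_ ?_
  · intro x hx
    have e1 := (((((hasDerivAt_pow 3 x).const_mul c₅).add ((hasDerivAt_pow 2 x).const_mul c₄)).add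
      ((hasDerivAt_id x).const_mul c₃)).add_const c₂).add
      (((hasDerivAt_id x).fun_inv hx.ne').const_mul c₁)
    have e2 := e1.add (((hasDerivAt_pow 2 x).fun_inv (pow_pos hx 2).ne').const_mul c₀)
    refine e2.congr_deriv ?_
    simp only [id, Nat.cast_ofNat, Nat.add_one_sub_one]
    field_simp
    ring
  · intro x hx
    have e1 := ((((hasDerivAt_pow 2 x).const_mul (3 * c₅)).add
      ((hasDerivAt_id x).const_mul (2 * c₄))).add_const c₃).sub
      (((hasDerivAt_pow 2 x).fun_inv (pow_pos hx 2).ne').const_mul c₁)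
    have e2 := e1.sub (((hasDerivAt_pow 3 x).fun_inv (pow_pos hx 3).ne').const_mul (2 * c₀))
    refine e2.congr_deriv ?_
    simp only [Nat.cast_ofNat, Nat.add_one_sub_one]
    field_simp
    ring
  · intro x hx y hy hxy
    have hx : 0 < x := hx
    have i3 : 1 / y ^ 3 < 1 / x ^ 3 := by gcongr
    have i4 : 1 / y ^ 4 < 1 / x ^ 4 := by gcongr
    have t1 : 6 * c₅ * x ≤ 6 * c₅ * y := by gcongr
    have t2 : c₁ * (1 / x ^ 3) ≤ c₁ * (1 / y ^ 3) := mul_le_mul_of_nonpos_left i3.le h1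
    have t3 : c₀ * (1 / x ^ 4) ≤ c₀ * (1 / y ^ 4) := mul_le_mul_of_nonpos_left i4.le h0
    have s1 : ∀ z : ℝ, 6 * c₅ * z + 2 * c₄ + 2 * c₁ / z ^ 3 + 6 * c₀ / z ^ 4 =
      6 * c₅ * z + 2 * c₄ + 2 * (c₁ * (1 / z ^ 3)) + 6 * (c₀ * (1 / z ^ 4)) := fun z => by ring
    simp only [s1]
    rcases h with h | h
    · have : 6 * c₅ * x < 6 * c₅ * y := by gcongr
      linarith
    · have : c₀ * (1 / x ^ 4) < c₀ * (1 / y ^ 4) := mul_lt_mul_of_neg_left i4 h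
      linarith

theorem encard_quinticPosZeros_le_two {c₅ c₄ c₃ c₂ c₁ c₀ : ℝ} (h5 : 0 ≤ c₅) (h4 : 0 ≤ c₄)
    (h1 : 0 < c₁) (h0 : 0 ≤ c₀) :
    (quinticPosZeros c₅ c₄ c₃ c₂ c₁ c₀).encard ≤ 2 := by
  rw [quinticPosZeros_eq_of_div (f := fun x => c₁ * x⁻¹ + (c₀ * x ^ (-2 : ℤ) +
    (c₅ * x ^ 3 + (c₄ * x ^ 2 + (c₃ * x + c₂))))) 2 (by
      intro x hx; simp only [quintic]
      have : x ^ (-2 : ℤ) = (x ^ 2)⁻¹ := by rw [zpow_neg]; norm_cast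
      rw [this]; field_simp; ring)]
  apply StrictConvexOn.encard_zeros_le_two
  have hinv : StrictConvexOn ℝ (Set.Ioi (0 : ℝ)) (fun x : ℝ => x⁻¹) := by
    have := strictConvexOn_zpow (m := -1) (by norm_num) (by norm_num)
    simpa using this
  have hinv' : StrictConvexOn ℝ (Set.Ioi (0 : ℝ)) (fun x : ℝ => c₁ * x⁻¹) := by
    refine ⟨hinv.1, fun x hx y hy hxy a b ha hb hab => ?_⟩
    have := mul_lt_mul_of_pos_left (hinv.2 hx hy hxy ha hb hab) h1
    simp only [smul_eq_mul] at this ⊢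
    linarith
  have hpow : ∀ n : ℕ, ConvexOn ℝ (Set.Ioi (0 : ℝ)) (fun x : ℝ => x ^ n) := fun n =>
    (convexOn_pow n).subset Set.Ioi_subset_Ici_self (convex_Ioi 0)
  refine hinv'.add_convexOn (((convexOn_zpow (-2)).smul h0).add
    (((hpow 3).smul h5).add (((hpow 2).smul h4).add ?_)))
  refine ⟨convex_Ioi 0, fun x _ y _ a b _ _ hab => ?_⟩
  have hc : c₂ = (a + b) * c₂ := by rw [hab, one_mul]
  simp only [smul_eq_mul]
  linarith

/-- There is a single sign change, after $c_3$ or before $c_2$. Division by $x^2$ if $c_3\ge0$, or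
by $x^3$ if $c_2\le0$, leaves a sum of nondecreasing terms; the last hypothesis makes one of them
strictly increasing. -/
theorem encard_quinticPosZeros_le_one {c₅ c₄ c₃ c₂ c₁ c₀ : ℝ} (h5 : 0 ≤ c₅) (h4 : 0 ≤ c₄)
    (h1 : c₁ ≤ 0) (h0 : c₀ ≤ 0) (h32 : 0 ≤ c₃ ∨ c₂ ≤ 0) (h : 0 < c₅ ∨ c₀ < 0 ∨ 0 < c₃ ∧ c₂ < 0) :
    (quinticPosZeros c₅ c₄ c₃ c₂ c₁ c₀).encard ≤ 1 := by
  have key : ∀ {x y : ℝ}, 0 < x → x < y →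
      (∀ n : ℕ, n ≠ 0 → x ^ n < y ^ n ∧ 1 / y ^ n < 1 / x ^ n) := by
    intro x y hx hxy n hn
    have : x ^ n < y ^ n := by gcongr
    exact ⟨this, one_div_lt_one_div_of_lt (pow_pos hx n) this⟩
  rcases h32 with h3 | h2
  · rw [quinticPosZeros_eq_of_div (f := fun x => c₅ * x ^ 3 + c₄ * x ^ 2 + c₃ * x + c₂
      + c₁ * (1 / x ^ 1) + c₀ * (1 / x ^ 2)) 2 (by intro x hx; simp only [quintic]; field_simp)]
    apply StrictMonoOn.encard_zeros_le_one
    intro x hx y hy hxy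
    have k := key hx hxy
    have t5 := mul_le_mul_of_nonneg_left (k 3 (by norm_num)).1.le h5
    have t4 := mul_le_mul_of_nonneg_left (k 2 (by norm_num)).1.le h4
    have t3 := mul_le_mul_of_nonneg_left hxy.le h3
    have t1 := mul_le_mul_of_nonpos_left (k 1 (by norm_num)).2.le h1
    have t0 := mul_le_mul_of_nonpos_left (k 2 (by norm_num)).2.le h0
    simp only
    rcases h with h | h | h
    · have := mul_lt_mul_of_pos_left (k 3 (by norm_num)).1 h
      linarith
    · have := mul_lt_mul_of_neg_left (k 2 (by norm_num)).2 h
      linarith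
    · have := mul_lt_mul_of_pos_left hxy h.1
      linarith
  · rw [quinticPosZeros_eq_of_div (f := fun x => c₅ * x ^ 2 + c₄ * x + c₃ + c₂ * (1 / x ^ 1)
      + c₁ * (1 / x ^ 2) + c₀ * (1 / x ^ 3)) 3 (by intro x hx; simp only [quintic]; field_simp)]
    apply StrictMonoOn.encard_zeros_le_one
    intro x hx y hy hxy
    have k := key hx hxy
    have t5 := mul_le_mul_of_nonneg_left (k 2 (by norm_num)).1.le h5
    have t4 := mul_le_mul_of_nonneg_left hxy.le h4
    have t2 := mul_le_mul_of_nonpos_left (k 1 (by norm_num)).2.le h2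
    have t1 := mul_le_mul_of_nonpos_left (k 2 (by norm_num)).2.le h1
    have t0 := mul_le_mul_of_nonpos_left (k 3 (by norm_num)).2.le h0
    simp only
    rcases h with h | h | h
    · have := mul_lt_mul_of_pos_left (k 2 (by norm_num)).1 h
      linarith
    · have := mul_lt_mul_of_neg_left (k 3 (by norm_num)).2 h
      linarith
    · have := mul_lt_mul_of_neg_left (k 1 (by norm_num)).2 h.2
      linarith

/-! ### Shapes of collinear central configurations -/

/-- The ratio `ρ` of the two adjacent distances of a collinear central configuration with positive
multiplier of three bodies of masses `a`, `b`, `c`, in this order on the line. The coefficients of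
the potential are `A` (first pair), `B` (second pair) and `C` (outer pair). -/
def IsCollinearShape (a b c A B C ρ : ℝ) : Prop :=
  0 < ρ ∧ ∃ κ τ : ℝ, 0 < κ ∧ A = κ * a * b + τ ∧ B = κ * b * c * ρ ^ 3 + τ * ρ ^ 2 ∧
    C = κ * a * c * (1 + ρ) ^ 3 - τ * (1 + ρ) ^ 2

theorem IsCollinearShape.reverse {a b c A B C ρ : ℝ} (h : IsCollinearShape a b c A B C ρ) :
    IsCollinearShape c b a B A C ρ⁻¹ := by
  obtain ⟨hρ, κ, τ, hκ, rfl, rfl, rfl⟩ := h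
  -- The unit of length changes from the first gap to the second.
  refine ⟨by positivity, κ * ρ ^ 3, τ * ρ ^ 2, by positivity, by ring, ?_, ?_⟩
  · field_simp
  · field_simp
    ring

theorem encard_collinearShape_reverse (a b c A B C : ℝ) :
    {ρ | IsCollinearShape c b a B A C ρ}.encard = {ρ | IsCollinearShape a b c A B C ρ}.encard := by
  have : {ρ | IsCollinearShape c b a B A C ρ} =
      (fun ρ : ℝ => ρ⁻¹) '' {ρ | IsCollinearShape a b c A B C ρ} := by
    ext ρ
    constructor
    · intro h
      exact ⟨ρ⁻¹, IsCollinearShape.reverse h, inv_inv ρ⟩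
    · rintro ⟨σ, h, rfl⟩
      exact IsCollinearShape.reverse h
  rw [this, inv_injective.encard_image]

/-- The coefficients of Euler's quintic equation. -/
theorem IsCollinearShape.mem_quinticPosZeros {a b c A B C ρ : ℝ}
    (h : IsCollinearShape a b c A B C ρ) :
    ρ ∈ quinticPosZeros (A * c * (a + b)) (A * c * (3 * a + 2 * b))
      (A * c * (b + 3 * a) - B * a * c + C * b * c) (A * a * c - B * a * (3 * c + b) - C * a * b)
      (-(B * a * (3 * c + 2 * b))) (-(B * a * (c + b))) := by
  obtain ⟨hρ, κ, τ, hκ, rfl, rfl, rfl⟩ := h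
  refine ⟨hρ, ?_⟩
  simp only [quintic]
  -- Up to sign the quintic is the $3\times3$ determinant expressing compatibility of the three
  -- linear equations for $(\kappa,\tau)$. It forgets $\kappa>0$, so only this inclusion holds.
  ring

section

variable {a b c A B C : ℝ}

/-- If the outer coefficient is nonpositive, then $\tau>0$, which makes both adjacent coefficients
positive. -/
theorem not_isCollinearShape (ha : 0 < a) (hb : 0 < b) (hc : 0 < c) (hC : C ≤ 0)
    (h : A ≤ 0 ∨ B ≤ 0) (ρ : ℝ) : ¬ IsCollinearShape a b c A B C ρ := by
  rintro ⟨hρ, κ, τ, hκ, rfl, rfl, rfl⟩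
  have h1 : 0 < τ := by
    by_contra! hτ
    have : 0 < κ * a * c * (1 + ρ) ^ 3 := by positivity
    have : τ * (1 + ρ) ^ 2 ≤ 0 := mul_nonpos_of_nonpos_of_nonneg hτ (by positivity)
    linarith
  rcases h with h | h
  · have : 0 < κ * a * b + τ := by positivity
    linarith
  · have : 0 < κ * b * c * ρ ^ 3 + τ * ρ ^ 2 := by positivity
    linarith

theorem encard_collinearShape_le_three (ha : 0 < a) (hb : 0 < b) (hc : 0 < c)
    (h : (0 < A ∧ 0 < B) ∨ (A ≤ 0 ∧ B ≤ 0 ∧ (A < 0 ∨ B < 0))) :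
    {ρ | IsCollinearShape a b c A B C ρ}.encard ≤ 3 := by
  refine (Set.encard_le_encard fun ρ hρ => IsCollinearShape.mem_quinticPosZeros hρ).trans ?_
  rcases h with ⟨hA, hB⟩ | ⟨hA, hB, h⟩
  · apply encard_quinticPosZeros_le_three
    · positivity
    · simp only [Left.neg_nonpos_iff]; positivity
    · simp only [Left.neg_nonpos_iff]; positivity
    · left; positivity
  · rw [← quinticPosZeros_neg]
    have hA' : 0 ≤ -A := by linarith
    have hB' : 0 ≤ -B := by linarith
    apply encard_quinticPosZeros_le_three
    · have : 0 ≤ (-A) * c * (a + b) := by positivity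
      linarith
    · have : 0 ≤ (-B) * a * (3 * c + 2 * b) := by positivity
      linarith
    · have : 0 ≤ (-B) * a * (c + b) := by positivity
      linarith
    · rcases h with h | h
      · left
        have h : 0 < -A := by linarith
        have : 0 < (-A) * c * (a + b) := by positivity
        linarith
      · right
        have h : 0 < -B := by linarith
        have : 0 < (-B) * a * (c + b) := by positivity
        linarith

theorem encard_collinearShape_le_two (ha : 0 < a) (hb : 0 < b) (hc : 0 < c) (hA : A ≤ 0)
    (hB : 0 < B) : {ρ | IsCollinearShape a b c A B C ρ}.encard ≤ 2 := by
  refine (Set.encard_le_encard fun ρ hρ => IsCollinearShape.mem_quinticPosZeros hρ).trans ?_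
  rw [← quinticPosZeros_neg]
  have hA' : 0 ≤ -A := by linarith
  apply encard_quinticPosZeros_le_two
  · have : 0 ≤ (-A) * c * (a + b) := by positivity
    linarith
  · have : 0 ≤ (-A) * c * (3 * a + 2 * b) := by positivity
    linarith
  · rw [neg_neg]; positivity
  · rw [neg_neg]; positivity

theorem encard_collinearShape_le_one_of_nonneg (ha : 0 < a) (hb : 0 < b) (hc : 0 < c) (hA : 0 ≤ A)
    (hB : 0 ≤ B) (hC : 0 < C) : {ρ | IsCollinearShape a b c A B C ρ}.encard ≤ 1 := by
  refine (Set.encard_le_encard fun ρ hρ => IsCollinearShape.mem_quinticPosZeros hρ).trans ?_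
  have hCbc : 0 < C * b * c := by positivity
  have hCab : 0 < C * a * b := by positivity
  apply encard_quinticPosZeros_le_one
  · positivity
  · positivity
  · simp only [Left.neg_nonpos_iff]; positivity
  · simp only [Left.neg_nonpos_iff]; positivity
  -- If $A\le B$, the negative terms dominate in $c_2$; if $B\le A$, the positive ones dominate in
  -- $c_3$.
  · rcases le_total A B with hAB | hAB
    · right
      have : A * a * c ≤ B * a * c := by gcongr
      have : 0 ≤ B * a * c := by positivity
      have : 0 ≤ B * a * b := by positivity
      nlinarith
    · left
      have : B * a * c ≤ A * a * c := by gcongr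
      have : 0 ≤ A * a * c := by positivity
      have : 0 ≤ A * b * c := by positivity
      nlinarith
  · rcases hA.lt_or_eq with hA | rfl
    · left; positivity
    · rcases hB.lt_or_eq with hB | rfl
      · right; left
        simp only [Left.neg_neg_iff]; positivity
      · right; right
        constructor <;> linarith

/-- Here $c_2=(A-3B)ac-(B+C)ab$, so $c_2>0$ forces $A>3B$. Then $c_3=(3A-B)ac+(A-B)bc+(B+C)bc$ is
positive, and again only one sign change is possible. -/
theorem encard_collinearShape_le_one_of_neg_lt (ha : 0 < a) (hb : 0 < b) (hc : 0 < c) (hA : 0 < A)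
    (hB : 0 < B) (hC : -C < B) : {ρ | IsCollinearShape a b c A B C ρ}.encard ≤ 1 := by
  refine (Set.encard_le_encard fun ρ hρ => IsCollinearShape.mem_quinticPosZeros hρ).trans ?_
  apply encard_quinticPosZeros_le_one
  · positivity
  · positivity
  · simp only [Left.neg_nonpos_iff]; positivity
  · simp only [Left.neg_nonpos_iff]; positivity
  · rw [or_iff_not_imp_right, not_le]
    intro h
    have hab : 0 < (B + C) * (a * b) := mul_pos (by linarith) (by positivity)
    have hbc : 0 < (B + C) * (b * c) := mul_pos (by linarith) (by positivity)
    have hAB : 3 * B < A := by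
      by_contra! hAB
      have : A * (a * c) ≤ 3 * B * (a * c) := by gcongr
      nlinarith
    have h1 : 3 * B * (a * c) < A * (a * c) := by gcongr
    have h2 : 3 * B * (b * c) < A * (b * c) := by gcongr
    have : 0 < B * (a * c) := by positivity
    have : 0 < B * (b * c) := by positivity
    nlinarith
  · left; positivity

/-- A nonpositive adjacent coefficient forces $\tau<0$. The first bound makes two orders
incompatible; the second supplies the hypothesis of `encard_collinearShape_le_one_of_neg_lt` for
another order. -/
theorem IsCollinearShape.bounds_of_nonpos {ρ : ℝ} (h : IsCollinearShape a b c A B C ρ)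
    (ha : 0 < a) (hb : 0 < b) (hc : 0 < c) (hA : A ≤ 0) : B * a < C * b ∧ -A < C := by
  obtain ⟨hρ, κ, τ, hκ, rfl, rfl, rfl⟩ := h
  have hκab : 0 < κ * a * b := by positivity
  have hτ : 0 < -τ := by linarith
  have h1 : 0 < κ * a * c * (1 + ρ) ^ 3 := by positivity
  constructor
  · have e1 : κ * a * b * c * ρ ^ 3 < κ * a * b * c * (1 + ρ) ^ 3 := by
      gcongr; linarith
    have e2 : 0 < (-τ) * ρ ^ 2 * a := by positivity
    have e3 : 0 < (-τ) * (1 + ρ) ^ 2 * b := by positivity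
    linarith
  · nlinarith [mul_pos hτ hρ, mul_pos (mul_pos hτ hρ) hρ]

end

/-- The two orders having $C$ as an adjacent coefficient exclude each other, since they require
$Ac<Ba$ and $Ba<Ac$. If one occurs, it contributes at most two shapes and bounds $-C$, so that the
order with $C$ outside contributes at most one. If neither occurs, the latter alone contributes at
most three. -/
theorem encard_collinearShape_sum_le_of_two_pos {a b c A B C : ℝ} (ha : 0 < a) (hb : 0 < b)
    (hc : 0 < c) (hA : 0 < A) (hB : 0 < B) (hC : C ≤ 0) :
    {ρ | IsCollinearShape a b c A B C ρ}.encard + {ρ | IsCollinearShape c a b C A B ρ}.encard +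
      {ρ | IsCollinearShape b c a B C A ρ}.encard ≤ 3 := by
  rw [← encard_collinearShape_reverse b c a B C A]
  rcases Set.eq_empty_or_nonempty {ρ | IsCollinearShape c a b C A B ρ} with h1 | ⟨ρ, h1⟩
  · rcases Set.eq_empty_or_nonempty {ρ | IsCollinearShape a c b C B A ρ} with h2 | ⟨σ, h2⟩
    · rw [h1, h2]
      simpa using encard_collinearShape_le_three ha hb hc (Or.inl ⟨hA, hB⟩)
    · have hb2 := h2.bounds_of_nonpos ha hc hb hC
      rw [h1, ← encard_collinearShape_reverse a b c A B C]
      have e1 := encard_collinearShape_le_one_of_neg_lt hc hb ha hB hA hb2.2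
      have e2 := encard_collinearShape_le_two (C := A) ha hc hb hC hB
      calc _ ≤ (1 : ℕ∞) + 0 + 2 := by
            gcongr; simp
        _ = 3 := by norm_num
  · have hb1 := h1.bounds_of_nonpos hc ha hb hC
    have h2 : {ρ | IsCollinearShape a c b C B A ρ} = ∅ := by
      rw [Set.eq_empty_iff_forall_notMem]
      intro σ h2
      have hb2 := IsCollinearShape.bounds_of_nonpos h2 ha hc hb hC
      linarith [hb1.1, hb2.1]
    rw [h2]
    have e1 := encard_collinearShape_le_one_of_neg_lt ha hb hc hA hB hb1.2
    have e2 := encard_collinearShape_le_two (C := B) hc ha hb hC hA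
    calc _ ≤ (1 : ℕ∞) + 2 + 0 := by
          gcongr; simp
      _ = 3 := by norm_num

/-- Only the order with the positive coefficient outside survives `not_isCollinearShape`. -/
theorem encard_collinearShape_sum_le_of_one_pos {a b c A B C : ℝ} (ha : 0 < a) (hb : 0 < b)
    (hc : 0 < c) (hA : A ≤ 0) (hB : B ≤ 0) (hC : 0 < C) :
    {ρ | IsCollinearShape a b c A B C ρ}.encard + {ρ | IsCollinearShape c a b C A B ρ}.encard +
      {ρ | IsCollinearShape b c a B C A ρ}.encard ≤ 3 := by
  have h1 : {ρ | IsCollinearShape c a b C A B ρ} = ∅ :=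
    Set.eq_empty_iff_forall_notMem.2 (not_isCollinearShape hc ha hb hB (Or.inr hA))
  have h2 : {ρ | IsCollinearShape b c a B C A ρ} = ∅ :=
    Set.eq_empty_iff_forall_notMem.2 (not_isCollinearShape hb hc ha hA (Or.inl hB))
  rw [h1, h2]
  simp only [Set.encard_empty, add_zero]
  by_cases h : A < 0 ∨ B < 0
  · exact encard_collinearShape_le_three ha hb hc (Or.inr ⟨hA, hB, h⟩)
  · push Not at h
    exact (encard_collinearShape_le_one_of_nonneg ha hb hc h.1 h.2 hC).trans (by norm_num)

theorem encard_collinearShape_sum_le {a b c A B C : ℝ} (ha : 0 < a) (hb : 0 < b) (hc : 0 < c) :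
    {ρ | IsCollinearShape a b c A B C ρ}.encard + {ρ | IsCollinearShape c a b C A B ρ}.encard +
      {ρ | IsCollinearShape b c a B C A ρ}.encard ≤ 3 := by
  have rot : ∀ x y z : ℕ∞, x + y + z = y + z + x := fun x y z => by abel
  rcases lt_or_ge 0 A with hA | hA <;> rcases lt_or_ge 0 B with hB | hB <;>
    rcases lt_or_ge 0 C with hC | hC
  · calc _ ≤ (1 : ℕ∞) + 1 + 1 := by
          gcongr <;> apply encard_collinearShape_le_one_of_nonneg <;>
            first | assumption | exact le_of_lt ‹_›
      _ = 3 := by norm_num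
  · exact encard_collinearShape_sum_le_of_two_pos ha hb hc hA hB hC
  · rw [rot]
    exact encard_collinearShape_sum_le_of_two_pos hc ha hb hC hA hB
  · rw [rot, rot]
    exact encard_collinearShape_sum_le_of_one_pos hb hc ha hB hC hA
  · rw [rot, rot]
    exact encard_collinearShape_sum_le_of_two_pos hb hc ha hB hC hA
  · rw [rot]
    exact encard_collinearShape_sum_le_of_one_pos hc ha hb hC hA hB
  · exact encard_collinearShape_sum_le_of_one_pos ha hb hc hA hB hC
  · have e0 : {ρ | IsCollinearShape a b c A B C ρ} = ∅ :=
      Set.eq_empty_iff_forall_notMem.2 (not_isCollinearShape ha hb hc hC (Or.inr hB))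
    have e1 : {ρ | IsCollinearShape c a b C A B ρ} = ∅ :=
      Set.eq_empty_iff_forall_notMem.2 (not_isCollinearShape hc ha hb hB (Or.inr hA))
    have e2 : {ρ | IsCollinearShape b c a B C A ρ} = ∅ :=
      Set.eq_empty_iff_forall_notMem.2 (not_isCollinearShape hb hc ha hA (Or.inl hB))
    rw [e0, e1, e2]
    simp

/-! ### The vector product -/

theorem inner_eq_sum_three (x y : Space3) : ⟪x, y⟫ = x 0 * y 0 + x 1 * y 1 + x 2 * y 2 := by
  simp only [PiLp.inner_apply, Fin.sum_univ_three, RCLike.inner_apply, conj_trivial]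
  ring

theorem cross3_apply_zero (x y : Space3) : cross3 x y 0 = x 1 * y 2 - x 2 * y 1 := by
  simp [cross3, cross_apply]

theorem cross3_apply_one (x y : Space3) : cross3 x y 1 = x 2 * y 0 - x 0 * y 2 := by
  simp [cross3, cross_apply]

theorem cross3_apply_two (x y : Space3) : cross3 x y 2 = x 0 * y 1 - x 1 * y 0 := by
  simp [cross3, cross_apply]

theorem Space3.ext {x y : Space3} (h0 : x 0 = y 0) (h1 : x 1 = y 1) (h2 : x 2 = y 2) : x = y := by
  ext i
  fin_cases i
  · exact h0
  · exact h1
  · exact h2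

theorem inner_cross3_left (x y z : Space3) : ⟪x, cross3 y z⟫ = ⟪cross3 x y, z⟫ := by
  simp only [inner_eq_sum_three, cross3_apply_zero, cross3_apply_one, cross3_apply_two]
  ring

theorem inner_cross3_rotate (x y z : Space3) : ⟪x, cross3 y z⟫ = ⟪cross3 z x, y⟫ := by
  simp only [inner_eq_sum_three, cross3_apply_zero, cross3_apply_one, cross3_apply_two]
  ring

theorem cross3_cross3_self (x y : Space3) :
    cross3 x (cross3 x y) = ⟪x, y⟫ • x - ‖x‖ ^ 2 • y := by
  rw [← real_inner_self_eq_norm_sq]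
  apply Space3.ext <;>
  simp only [inner_eq_sum_three, cross3_apply_zero, cross3_apply_one, cross3_apply_two,
    PiLp.sub_apply, PiLp.smul_apply, smul_eq_mul] <;> ring

theorem cross3_swap (x y : Space3) : cross3 x y = -cross3 y x := by
  apply Space3.ext <;>
  simp only [cross3_apply_zero, cross3_apply_one, cross3_apply_two, PiLp.neg_apply] <;> ring

/-- The vector product as a bilinear map. -/
noncomputable def cross3Bilin : Space3 →ₗ[ℝ] Space3 →ₗ[ℝ] Space3 :=
  LinearMap.mk₂ ℝ cross3
    (fun x x' y => by
      apply Space3.ext <;>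
      simp only [cross3_apply_zero, cross3_apply_one, cross3_apply_two, PiLp.add_apply] <;> ring)
    (fun c x y => by
      apply Space3.ext <;>
      simp only [cross3_apply_zero, cross3_apply_one, cross3_apply_two, PiLp.smul_apply,
        smul_eq_mul] <;> ring)
    (fun x y y' => by
      apply Space3.ext <;>
      simp only [cross3_apply_zero, cross3_apply_one, cross3_apply_two, PiLp.add_apply] <;> ring)
    (fun c x y => by
      apply Space3.ext <;>
      simp only [cross3_apply_zero, cross3_apply_one, cross3_apply_two, PiLp.smul_apply,
        smul_eq_mul] <;> ring)

@[simp]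
theorem cross3Bilin_apply (x y : Space3) : cross3Bilin x y = cross3 x y := rfl

theorem cross3_smul_left (c : ℝ) (x y : Space3) : cross3 (c • x) y = c • cross3 x y :=
  cross3Bilin.map_smul₂ c x y

theorem cross3_smul_right (c : ℝ) (x y : Space3) : cross3 x (c • y) = c • cross3 x y :=
  (cross3Bilin x).map_smul c y

theorem cross3_zero_right (x : Space3) : cross3 x 0 = 0 := (cross3Bilin x).map_zero

theorem inner_cross3_eq_det (x y z : Space3) :
    ⟪x, cross3 y z⟫ = (EuclideanSpace.basisFun (Fin 3) ℝ).toBasis.det ![x, y, z] := by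
  rw [Module.Basis.det_apply, Matrix.det_fin_three]
  simp only [inner_eq_sum_three, cross3_apply_zero, cross3_apply_one, cross3_apply_two,
    Module.Basis.toMatrix_apply, OrthonormalBasis.coe_toBasis_repr_apply,
    EuclideanSpace.basisFun_repr, Matrix.cons_val]
  ring

/-- The triple product is a determinant, hence invariant under maps of determinant $1$. -/
theorem LinearIsometryEquiv.map_cross3 (R : Space3 ≃ₗᵢ[ℝ] Space3)
    (hR : LinearMap.det (R.toLinearEquiv : Space3 →ₗ[ℝ] Space3) = 1) (x y : Space3) :
    R (cross3 x y) = cross3 (R x) (R y) := by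
  refine ext_inner_left ℝ fun w => ?_
  obtain ⟨z, rfl⟩ := R.surjective w
  rw [R.inner_map_map, inner_cross3_eq_det, inner_cross3_eq_det]
  have h := Module.Basis.det_comp (EuclideanSpace.basisFun (Fin 3) ℝ).toBasis
    (R.toLinearEquiv : Space3 →ₗ[ℝ] Space3) ![z, x, y]
  rw [hR, one_mul] at h
  rw [← h]
  congr 1
  ext i
  fin_cases i <;> rfl

/-! ### Isometries with prescribed values -/

/-- Equal Gram matrices give equal norms of linear combinations. So $v_i\mapsto w_i$ is well defined
and isometric on the span, and in finite dimension it extends. -/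
theorem exists_linearIsometryEquiv_of_inner_eq {ι E : Type*} [NormedAddCommGroup E]
    [InnerProductSpace ℝ E] [FiniteDimensional ℝ E] (v w : ι → E)
    (h : ∀ i j, ⟪v i, v j⟫ = ⟪w i, w j⟫) : ∃ R : E ≃ₗᵢ[ℝ] E, ∀ i, R (v i) = w i := by
  have hinner : ∀ c d : ι →₀ ℝ, ⟪Finsupp.linearCombination ℝ v c, Finsupp.linearCombination ℝ v d⟫ =
      ⟪Finsupp.linearCombination ℝ w c, Finsupp.linearCombination ℝ w d⟫ := by
    intro c d
    simp only [Finsupp.linearCombination_apply, Finsupp.sum, sum_inner, inner_sum,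
      real_inner_smul_left, real_inner_smul_right, h]
  have hker : LinearMap.ker (Finsupp.linearCombination ℝ v) ≤
      LinearMap.ker (Finsupp.linearCombination ℝ w) := by
    intro c hc
    rw [LinearMap.mem_ker] at hc ⊢
    rw [← inner_self_eq_zero (𝕜 := ℝ), ← hinner, hc, inner_zero_left]
  let f := Finsupp.linearCombination ℝ v
  let g : LinearMap.range f →ₗ[ℝ] E := (LinearMap.ker f).liftQ (Finsupp.linearCombination ℝ w) hker ∘ₗ
    (f.quotKerEquivRange.symm : LinearMap.range f →ₗ[ℝ] _)
  have hg : ∀ c, g ⟨f c, LinearMap.mem_range_self f c⟩ = Finsupp.linearCombination ℝ w c := by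
    intro c
    have : f.quotKerEquivRange.symm ⟨f c, LinearMap.mem_range_self f c⟩ =
        (LinearMap.ker f).mkQ c := LinearMap.quotKerEquivRange_symm_apply_image f c _
    simp only [g, LinearMap.comp_apply, LinearEquiv.coe_coe]
    rw [this, Submodule.mkQ_apply, Submodule.liftQ_apply]
  let L : LinearMap.range f →ₗᵢ[ℝ] E := g.isometryOfInner (by
    rintro ⟨_, c, rfl⟩ ⟨_, d, rfl⟩
    rw [hg, hg, Submodule.coe_inner, ← hinner])
  refine ⟨L.extend.toLinearIsometryEquiv rfl, fun i => ?_⟩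
  have hi : f (Finsupp.single i 1) = v i := by simp [f]
  have h1 := L.extend_apply ⟨v i, hi ▸ LinearMap.mem_range_self f _⟩
  have h2 := hg (Finsupp.single i 1)
  simp only [hi, Finsupp.linearCombination_single, one_smul] at h2
  rw [LinearIsometry.coe_toLinearIsometryEquiv]
  exact h1.trans h2

theorem LinearIsometryEquiv.det_eq_one_or_neg_one {E : Type*} [NormedAddCommGroup E]
    [InnerProductSpace ℝ E] [FiniteDimensional ℝ E] (R : E ≃ₗᵢ[ℝ] E) :
    LinearMap.det (R.toLinearEquiv : E →ₗ[ℝ] E) = 1 ∨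
      LinearMap.det (R.toLinearEquiv : E →ₗ[ℝ] E) = -1 := by
  let b := stdOrthonormalBasis ℝ E
  have h := Module.Basis.det_comp b.toBasis (R.toLinearEquiv : E →ₗ[ℝ] E) b.toBasis
  rw [Module.Basis.det_self, mul_one] at h
  rw [← h]
  have h' := b.det_to_matrix_orthonormalBasis_real (b.map R)
  have e : (R.toLinearEquiv : E →ₗ[ℝ] E) ∘ b.toBasis = b.map R := by
    ext i
    simp
  rw [e]
  exact h'

theorem exists_rotation_of_inner_eq {ι : Type*} (v w : ι → Space3) {n n' : Space3}
    (hnn' : ‖n‖ = ‖n'‖) (hn0 : n ≠ 0) (hn : ∀ i, ⟪n, v i⟫ = 0) (hn' : ∀ i, ⟪n', w i⟫ = 0)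
    (h : ∀ i j, ⟪v i, v j⟫ = ⟪w i, w j⟫) :
    ∃ (R : Space3 ≃ₗᵢ[ℝ] Space3) (ε : ℝ),
      LinearMap.det (R.toLinearEquiv : Space3 →ₗ[ℝ] Space3) = 1 ∧ (ε = 1 ∨ ε = -1) ∧
      (∀ i, R (v i) = w i) ∧ R n = ε • n' := by
  obtain ⟨R, hR⟩ := exists_linearIsometryEquiv_of_inner_eq
    (fun o : Option ι => o.elim n v) (fun o : Option ι => o.elim n' w) (by
      rintro (_ | i) (_ | j)
      · simp [hnn']
      · simp [hn, hn']
      · simp only [Option.elim_some, Option.elim_none]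
        rw [real_inner_comm, hn, real_inner_comm, hn']
      · simp [h])
  have hRn : R n = n' := hR none
  have hRv : ∀ i, R (v i) = w i := fun i => hR (some i)
  rcases R.det_eq_one_or_neg_one with hdet | hdet
  · exact ⟨R, 1, hdet, Or.inl rfl, hRv, by rw [hRn, one_smul]⟩
  -- Reflecting first in the plane $n^\perp$ fixes every $v_i$, corrects the determinant and costs
  -- only the sign of $n$.
  · refine ⟨((ℝ ∙ n)ᗮ.reflection).trans R, -1, ?_, Or.inr rfl, fun i => ?_, ?_⟩
    · have h1 := LinearMap.det_comp (R.toLinearEquiv : Space3 →ₗ[ℝ] Space3)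
        ((ℝ ∙ n)ᗮ.reflection).toLinearMap
      rw [hdet, Submodule.det_reflection, Submodule.orthogonal_orthogonal,
        finrank_span_singleton hn0] at h1
      refine Eq.trans h1 ?_
      norm_num
    · rw [LinearIsometryEquiv.trans_apply, Submodule.reflection_mem_subspace_eq_self, hRv]
      exact Submodule.mem_orthogonal_singleton_iff_inner_right.2 (hn i)
    · rw [LinearIsometryEquiv.trans_apply,
        Submodule.reflection_orthogonalComplement_singleton_eq_neg, map_neg, hRn, neg_one_smul]

/-! ### Gradients -/

theorem HasGradientAt.congr_add_const {E : Type*} [NormedAddCommGroup E] [InnerProductSpace ℝ E]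
    [CompleteSpace E] {f g : E → ℝ} {f' x : E} (hf : HasGradientAt f f' x) {c : ℝ}
    (h : ∀ v, g v = f v + c) : HasGradientAt g f' x := by
  obtain rfl : g = fun v => f v + c := funext h
  rw [hasGradientAt_iff_hasFDerivAt] at hf ⊢
  exact hf.add_const c

theorem hasGradientAt_inner_right {E : Type*} [NormedAddCommGroup E] [InnerProductSpace ℝ E]
    [CompleteSpace E] (w x : E) : HasGradientAt (fun v => ⟪w, v⟫) w x := by
  rw [hasGradientAt_iff_hasFDerivAt]
  exact (InnerProductSpace.toDual ℝ E w).hasFDerivAt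

theorem hasGradientAt_mul_norm_sq {E : Type*} [NormedAddCommGroup E] [InnerProductSpace ℝ E]
    [CompleteSpace E] (c : ℝ) (x : E) :
    HasGradientAt (fun v => c * ‖v‖ ^ 2) ((2 * c) • x) x := by
  rw [hasGradientAt_iff_hasFDerivAt]
  refine ((hasStrictFDerivAt_norm_sq x).hasFDerivAt.const_mul c).congr_fderiv ?_
  ext v
  simp
  ring

theorem hasGradientAt_neg_div_norm_sub {E : Type*} [NormedAddCommGroup E] [InnerProductSpace ℝ E]
    [CompleteSpace E] (g : ℝ) {w x : E} (hx : x ≠ w) :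
    HasGradientAt (fun v => -(g / ‖v - w‖)) ((g / ‖x - w‖ ^ 3) • (x - w)) x := by
  have h0 : ‖x - w‖ ≠ 0 := norm_ne_zero_iff.2 (sub_ne_zero.2 hx)
  rw [hasGradientAt_iff_hasFDerivAt]
  -- The norm is differentiated as the square root of its smooth square.
  have h1 : HasFDerivAt (fun v : E => ‖v - w‖ ^ 2) (2 • innerSL ℝ (x - w)) x :=
    ((hasFDerivAt_id x).sub_const w).norm_sq.congr_fderiv (by ext v; simp)
  have h2 := (h1.sqrt (pow_ne_zero 2 h0))
  simp only [Real.sqrt_sq (norm_nonneg _)] at h2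
  have h3 := ((hasDerivAt_inv h0).comp_hasFDerivAt x h2).const_mul (-g)
  have e : (fun v => -(g / ‖v - w‖)) = fun v => -g * ((fun y => y⁻¹) ∘ fun v => ‖v - w‖) v := by
    ext v
    simp [div_eq_mul_inv]
  rw [e]
  refine h3.congr_fderiv ?_
  ext v
  simp
  field_simp

/-- The contribution of the body `j` to the gradient of the potential at the body `i`. -/
noncomputable def ChargedSystem.pairGrad {N : ℕ} (S : ChargedSystem N) (q : Config N)
    (i j : Fin N) : Space3 :=
  (S.γ i j / ‖q i - q j‖ ^ 3) • (q i - q j)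

theorem ChargedSystem.potential_three (S : ChargedSystem 3) (q : Config 3) (i : Fin 3) :
    S.potential q = -(S.γ i (i + 1) / ‖q i - q (i + 1)‖) + -(S.γ i (i + 2) / ‖q i - q (i + 2)‖) +
      -(S.γ (i + 1) (i + 2) / ‖q (i + 1) - q (i + 2)‖) := by
  have e0 : Finset.Ioi (0 : Fin 3) = {1, 2} := by decide
  have e1 : Finset.Ioi (1 : Fin 3) = {2} := by decide
  have e2 : Finset.Ioi (2 : Fin 3) = ∅ := by decide
  have hs : ∀ i j, S.γ i j / ‖q i - q j‖ = S.γ j i / ‖q j - q i‖ := fun i j => by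
    rw [S.γ_symm, norm_sub_rev]
  simp only [potential, Fin.sum_univ_three, e0, e1, e2, Finset.sum_singleton, Finset.sum_empty,
    Finset.sum_pair (show (1 : Fin 3) ≠ 2 by decide)]
  fin_cases i
  · simp
  · simp only [Fin.mk_one, Fin.isValue, Fin.reduceAdd]
    rw [hs 1 0, hs 2 0]
    ring
  · simp only [Fin.reduceFinMk, Fin.isValue, Fin.reduceAdd]
    rw [hs 2 0, hs 2 1]
    ring

theorem ChargedSystem.hasGradientAt_potential (S : ChargedSystem 3) {q : Config 3}
    (hq : q ∈ configSpace 3) (i : Fin 3) :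
    HasGradientAt (fun v => S.potential (Function.update q i v))
      (S.pairGrad q i (i + 1) + S.pairGrad q i (i + 2)) (q i) := by
  have n1 : i ≠ i + 1 := by revert i; decide
  have n2 : i ≠ i + 2 := by revert i; decide
  have h1 := hasGradientAt_neg_div_norm_sub (S.γ i (i + 1)) (hq i (i + 1) n1)
  have h2 := hasGradientAt_neg_div_norm_sub (S.γ i (i + 2)) (hq i (i + 2) n2)
  have h12 : HasGradientAt (fun v => -(S.γ i (i + 1) / ‖v - q (i + 1)‖) +
      -(S.γ i (i + 2) / ‖v - q (i + 2)‖))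
      (S.pairGrad q i (i + 1) + S.pairGrad q i (i + 2)) (q i) := by
    rw [hasGradientAt_iff_hasFDerivAt] at h1 h2 ⊢
    rw [map_add]
    exact h1.add h2
  refine h12.congr_add_const (c := -(S.γ (i + 1) (i + 2) / ‖q (i + 1) - q (i + 2)‖)) fun v => ?_
  rw [S.potential_three _ i]
  simp only [Function.update_self, Function.update_of_ne n1.symm, Function.update_of_ne n2.symm]

theorem ChargedSystem.partialGrad_potential (S : ChargedSystem 3) {q : Config 3}
    (hq : q ∈ configSpace 3) (i : Fin 3) :
    partialGrad S.potential q i = S.pairGrad q i (i + 1) + S.pairGrad q i (i + 2) :=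
  (S.hasGradientAt_potential hq i).gradient

theorem partialGrad_sum {N : ℕ} {F : Fin N → Space3 → ℝ} {q : Config N} {i : Fin N} {g : Space3}
    (h : HasGradientAt (F i) g (q i)) (c : ℝ) :
    partialGrad (fun q => (∑ k, F k (q k)) + c) q i = g := by
  refine HasGradientAt.gradient
    (h.congr_add_const (c := (∑ k ∈ Finset.univ.erase i, F k (q k)) + c) fun v => ?_)
  change (∑ k, F k (Function.update q i v k)) + c = _
  rw [← Finset.add_sum_erase _ _ (Finset.mem_univ i), Function.update_self, add_assoc]
  congr 2
  refine Finset.sum_congr rfl fun k hk => ?_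
  rw [Function.update_of_ne (Finset.ne_of_mem_erase hk)]

theorem ChargedSystem.hamiltonianField_hamiltonian {N : ℕ} (S : ChargedSystem N) (x : Phase N) :
    hamiltonianField S.hamiltonian x =
      (fun i => (S.mass i)⁻¹ • x.2 i, fun i => -partialGrad S.potential x.1 i) := by
  refine Prod.ext (funext fun i => ?_) (funext fun i => ?_)
  · have h := hasGradientAt_mul_norm_sq (1 / (2 * S.mass i)) (x.2 i)
    change partialGrad (fun p => (∑ k, 1 / (2 * S.mass k) * ‖p k‖ ^ 2) + S.potential x.1) x.2 i =
      (S.mass i)⁻¹ • x.2 i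
    rw [partialGrad_sum (F := fun k v => 1 / (2 * S.mass k) * ‖v‖ ^ 2) h]
    congr 1
    have := (S.mass_pos i).ne'
    field_simp
  · simp only [hamiltonianField, hamiltonian, partialGrad, gradient]
    rw [fderiv_const_add]

theorem hamiltonianField_inner_angularMomentum {N : ℕ} (ξ : Space3) (x : Phase N) :
    hamiltonianField (fun y : Phase N => ⟪ξ, angularMomentum y⟫) x =
      (fun i => cross3 ξ (x.1 i), fun i => cross3 ξ (x.2 i)) := by
  refine Prod.ext (funext fun i => ?_) (funext fun i => ?_)
  · have h := hasGradientAt_inner_right (cross3 ξ (x.1 i)) (x.2 i)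
    refine Eq.trans ?_ (partialGrad_sum (F := fun k v => ⟪cross3 ξ (x.1 k), v⟫) h 0)
    simp only [hamiltonianField, angularMomentum, inner_sum, inner_cross3_left, add_zero]
  · have h := hasGradientAt_inner_right (cross3 (x.2 i) ξ) (x.1 i)
    change _ = cross3 ξ (x.2 i)
    rw [cross3_swap ξ, ← partialGrad_sum (F := fun k v => ⟪cross3 (x.2 k) ξ, v⟫) h 0]
    simp only [hamiltonianField, angularMomentum, inner_sum, inner_cross3_rotate, add_zero]

/-- This turns equality of Hamiltonian fields into equality of differentials. -/
theorem fderiv_apply_eq_sum_hamiltonianField {N : ℕ} {G : Phase N → ℝ} {x : Phase N}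
    (hG : DifferentiableAt ℝ G x) (v : Phase N) :
    fderiv ℝ G x v = (∑ i, ⟪(hamiltonianField G x).1 i, v.2 i⟫) -
      ∑ i, ⟪(hamiltonianField G x).2 i, v.1 i⟫ := by
  have hq : ∀ (i : Fin N) (u : Space3), fderiv ℝ G x (Pi.single i u, 0) =
      -⟪(hamiltonianField G x).2 i, u⟫ := by
    intro i u
    have h1 : HasFDerivAt (fun w : Space3 => (Function.update x.1 i w, x.2))
        ((ContinuousLinearMap.single ℝ (fun _ : Fin N => Space3) i).prod 0) (x.1 i) := by
      refine HasFDerivAt.prodMk ?_ (hasFDerivAt_const _ _)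
      refine (hasFDerivAt_update x.1 (x.1 i)).congr_fderiv ?_
      ext w k
      by_cases hk : k = i
      · subst hk; simp
      · simp [hk]
    have hG' : HasFDerivAt G (fderiv ℝ G x) (Function.update x.1 i (x.1 i), x.2) := by
      rw [Function.update_eq_self]
      exact hG.hasFDerivAt
    have h2 := HasFDerivAt.comp (x.1 i) hG' h1
    simp only [hamiltonianField, partialGrad, inner_neg_left, neg_neg]
    rw [gradient, InnerProductSpace.toDual_symm_apply]
    have h4 := h2.fderiv
    simp only [Function.comp_def] at h4
    rw [h4]
    simp
  have hp : ∀ (i : Fin N) (u : Space3), fderiv ℝ G x (0, Pi.single i u) =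
      ⟪(hamiltonianField G x).1 i, u⟫ := by
    intro i u
    have h1 : HasFDerivAt (fun w : Space3 => (x.1, Function.update x.2 i w))
        (ContinuousLinearMap.prod 0 (ContinuousLinearMap.single ℝ (fun _ : Fin N => Space3) i))
        (x.2 i) := by
      refine HasFDerivAt.prodMk (hasFDerivAt_const _ _) ?_
      refine (hasFDerivAt_update x.2 (x.2 i)).congr_fderiv ?_
      ext w k
      by_cases hk : k = i
      · subst hk; simp
      · simp [hk]
    have hG' : HasFDerivAt G (fderiv ℝ G x) (x.1, Function.update x.2 i (x.2 i)) := by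
      rw [Function.update_eq_self]
      exact hG.hasFDerivAt
    have h2 := HasFDerivAt.comp (x.2 i) hG' h1
    simp only [hamiltonianField, partialGrad]
    rw [gradient, InnerProductSpace.toDual_symm_apply]
    have h4 := h2.fderiv
    simp only [Function.comp_def] at h4
    rw [h4]
    simp
  have hv : v = (∑ i, ((Pi.single i (v.1 i), 0) : Phase N)) + ∑ i, (0, Pi.single i (v.2 i)) := by
    refine Prod.ext ?_ ?_
    · simp [Prod.fst_sum, Finset.univ_sum_single]
    · simp [Prod.snd_sum, Finset.univ_sum_single]
  conv_lhs => rw [hv]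
  rw [map_add, map_sum, map_sum]
  simp only [hq, hp, Finset.sum_neg_distrib]
  ring

/-! ### Relative equilibria -/

namespace ChargedSystem

variable {N : ℕ} (S : ChargedSystem N)

/-- Since $dH=d\langle\xi,L\rangle$, no tangent vector can change $H$ at first order while keeping
$L$. -/
theorem not_surjective_fderiv_integralMap {x : Phase N} {ξ : Space3}
    (h : hamiltonianField S.hamiltonian x =
      hamiltonianField (fun y : Phase N => ⟪ξ, angularMomentum y⟫) x) :
    ¬ Function.Surjective (fderiv ℝ S.integralMap x) := by
  intro hs
  obtain ⟨v, hv⟩ := hs (1, 0, 0, 0)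
  have hd : DifferentiableAt ℝ S.integralMap x := by
    -- Without differentiability `fderiv` is $0$ by convention, which is not surjective either.
    by_contra hd
    rw [fderiv_zero_of_not_differentiableAt hd] at hv
    exact zero_ne_one (congrArg Prod.fst hv)
  have hH : HasFDerivAt S.hamiltonian _ x := hd.hasFDerivAt.fst
  have hL : HasFDerivAt (fun y : Phase N => ⟪ξ, angularMomentum y⟫) _ x :=
    (innerSL ℝ ξ).hasFDerivAt.comp x hd.hasFDerivAt.snd.fst
  have e1 := fderiv_apply_eq_sum_hamiltonianField hH.differentiableAt v
  rw [h, ← fderiv_apply_eq_sum_hamiltonianField hL.differentiableAt v, hH.fderiv, hL.fderiv] at e1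
  simp [hv] at e1

/-- Uniform rotations of a central configuration about an axis through the center of mass. -/
structure IsRotating (ξ : Space3) (x : Phase N) : Prop where
  mem : x.1 ∈ configSpace N
  centerOfMass_eq : S.centerOfMass x.1 = 0
  axis_ne : ξ ≠ 0
  inner_eq : ∀ i, ⟪ξ, x.1 i⟫ = 0
  momentum_eq : ∀ i, x.2 i = S.mass i • cross3 ξ (x.1 i)
  grad_eq : ∀ i, partialGrad S.potential x.1 i = (S.mass i * ‖ξ‖ ^ 2) • x.1 i

theorem sum_mass_smul_eq_zero [NeZero N] {q : Config N} (h : S.centerOfMass q = 0) :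
    ∑ i, S.mass i • q i = 0 := by
  have : 0 < ∑ i, S.mass i := Finset.sum_pos (fun i _ => S.mass_pos i) Finset.univ_nonempty
  exact (smul_eq_zero.1 h).resolve_left (inv_ne_zero this.ne')

theorem exists_isRotating {x : Phase N} (hcm : S.centerOfMass x.1 = 0)
    (hrel : S.IsRelativeEquilibrium x) (hcc : S.IsCentralConfiguration x.1) :
    ∃ ξ, S.IsRotating ξ x := by
  obtain ⟨hx, hne, ξ, hξ⟩ := hrel
  obtain ⟨-, lam, hlam⟩ := hcc
  have hfield := hξ
  rw [hamiltonianField_inner_angularMomentum, S.hamiltonianField_hamiltonian,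
    Prod.mk.injEq] at hξ
  obtain ⟨h1, h2⟩ := hξ
  have hp : ∀ i, x.2 i = S.mass i • cross3 ξ (x.1 i) := fun i => by
    rw [← congrFun h1 i, smul_smul, mul_inv_cancel₀ (S.mass_pos i).ne', one_smul]
  have hgrad : ∀ i, partialGrad S.potential x.1 i =
      S.mass i • (‖ξ‖ ^ 2 • x.1 i - ⟪ξ, x.1 i⟫ • ξ) := fun i => by
    have := congrFun h2 i
    rw [hp, cross3_smul_right, cross3_cross3_self] at this
    rw [← neg_sub, smul_neg, ← this, neg_neg]
  have hcross : ¬ ∀ i, cross3 ξ (x.1 i) = 0 := by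
    intro h
    refine hne ⟨hx, ?_⟩
    rw [hfield, hamiltonianField_inner_angularMomentum]
    refine Prod.ext (funext h) (funext fun i => ?_)
    simp only [hp, h, smul_zero, cross3_zero_right]
    rfl
  have hlam' : ∀ i, lam • x.1 i = ‖ξ‖ ^ 2 • x.1 i - ⟪ξ, x.1 i⟫ • ξ := fun i => by
    have := (hlam i).symm.trans (hgrad i)
    rw [hcm, sub_zero, mul_comm, mul_smul] at this
    exact smul_right_injective _ (S.mass_pos i).ne' this
  have hinner : ∀ i, ⟪ξ, x.1 i⟫ = 0 := by
    have hl : ∀ i, lam * ⟪ξ, x.1 i⟫ = 0 := fun i => by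
      rw [← real_inner_smul_right, hlam', inner_sub_right, real_inner_smul_right,
        real_inner_smul_right, real_inner_self_eq_norm_sq]
      ring
    -- If some $q_k$ is not orthogonal to $\xi$, the multiplier vanishes. Then $\xi\times(\xi\times
    -- q_i)=0$, so $\xi\times q_i=0$ for all $i$, and the point is an equilibrium.
    by_contra! h
    obtain ⟨k, hk⟩ := h
    have hl0 : lam = 0 := (mul_eq_zero.1 (hl k)).resolve_right hk
    apply hcross
    intro i
    have h3 : cross3 ξ (cross3 ξ (x.1 i)) = 0 := by
      rw [cross3_cross3_self, ← neg_sub, ← hlam', hl0, zero_smul, neg_zero]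
    rw [← inner_self_eq_zero (𝕜 := ℝ), inner_cross3_left, real_inner_comm,
      cross3_swap, h3, neg_zero, inner_zero_right]
  refine ⟨ξ, hx, hcm, ?_, hinner, hp, fun i => ?_⟩
  · rintro rfl
    apply hcross
    intro i
    rw [cross3_swap, cross3_zero_right, neg_zero]
  · rw [hgrad, hinner, zero_smul, sub_zero, smul_smul]

variable {S}

theorem IsRotating.isCriticalPoint_and [NeZero N] {ξ : Space3} {x : Phase N}
    (h : S.IsRotating ξ x) (h0 : ∃ i, x.1 i ≠ 0) :
    S.IsCriticalPoint x ∧ S.IsRelativeEquilibrium x ∧ S.IsCentralConfiguration x.1 := by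
  have hfield : hamiltonianField S.hamiltonian x =
      hamiltonianField (fun y : Phase N => ⟪ξ, angularMomentum y⟫) x := by
    rw [hamiltonianField_inner_angularMomentum, S.hamiltonianField_hamiltonian]
    refine Prod.ext (funext fun i => ?_) (funext fun i => ?_)
    · simp only
      rw [h.momentum_eq, smul_smul, inv_mul_cancel₀ (S.mass_pos i).ne', one_smul]
    · simp only
      rw [h.momentum_eq, cross3_smul_right, cross3_cross3_self, h.inner_eq, h.grad_eq, zero_smul,
        zero_sub, smul_neg, smul_smul]
  refine ⟨⟨h.mem, ?_, h.centerOfMass_eq, S.not_surjective_fderiv_integralMap hfield⟩,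
    ⟨h.mem, ?_, ξ, hfield⟩, h.mem, ‖ξ‖ ^ 2, fun i => ?_⟩
  · have : totalMomentum x = cross3 ξ (∑ i, S.mass i • x.1 i) := by
      rw [← cross3Bilin_apply, map_sum]
      simp only [totalMomentum, h.momentum_eq, cross3Bilin_apply, cross3_smul_right]
    rw [this, S.sum_mass_smul_eq_zero h.centerOfMass_eq, cross3_zero_right]
  · rintro ⟨-, heq⟩
    obtain ⟨i, hi⟩ := h0
    rw [hfield, hamiltonianField_inner_angularMomentum] at heq
    have h1 : cross3 ξ (x.1 i) = 0 := congrFun (congrArg Prod.fst heq) i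
    have h2 := cross3_cross3_self ξ (x.1 i)
    rw [h1, cross3_zero_right, h.inner_eq, zero_smul, zero_sub, eq_comm, neg_eq_zero] at h2
    rcases smul_eq_zero.1 h2 with h3 | h3
    · exact h.axis_ne (norm_eq_zero.1 (pow_eq_zero_iff two_ne_zero |>.1 h3))
    · exact hi h3
  · rw [h.grad_eq, h.centerOfMass_eq, sub_zero, mul_comm]

theorem mem_collinearCriticalPoints_iff {S : ChargedSystem 3} {x : Phase 3} :
    x ∈ S.collinearCriticalPoints ↔
      (∃ ξ, S.IsRotating ξ x) ∧ Collinear ℝ (Set.range x.1) := by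
  constructor
  · rintro ⟨h1, h2, h3, h4⟩
    exact ⟨S.exists_isRotating h1.2.2.1 h2 h3, h4⟩
  · rintro ⟨⟨ξ, h⟩, h4⟩
    have h0 : ∃ i, x.1 i ≠ 0 := by
      by_contra! h0
      exact h.mem 0 1 (by decide) ((h0 0).trans (h0 1).symm)
    obtain ⟨h1, h2, h3⟩ := h.isCriticalPoint_and h0
    exact ⟨h1, h2, h3, h4⟩

end ChargedSystem

/-! ### Similarity of rotating configurations -/

namespace ChargedSystem

theorem pairGrad_eq_of_similar {N : ℕ} (S : ChargedSystem N) {q q' : Config N}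
    (R : Space3 ≃ₗᵢ[ℝ] Space3) {k : ℝ} (hk : 0 < k) (h : ∀ i, q' i = k • R (q i)) (i j : Fin N) :
    S.pairGrad q' i j = (k ^ 2)⁻¹ • R (S.pairGrad q i j) := by
  have e : q' i - q' j = k • R (q i - q j) := by rw [h, h, map_sub, smul_sub]
  rw [pairGrad, e, norm_smul, R.norm_map, pairGrad, map_smul, smul_smul, smul_smul,
    Real.norm_of_nonneg hk.le]
  congr 1
  rw [mul_pow, div_mul_eq_div_div]
  field_simp

/-- Distances determine the inner products of the differences from body $0$, so a rotation matches
the scaled configurations and their normals up to a sign. The scaling law of the gradient relates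
$|\xi'|$ to $|\xi|$. -/
theorem IsRotating.isSimilar {S : ChargedSystem 3} {ξ ξ' : Space3} {x y : Phase 3} {k : ℝ}
    (hx : S.IsRotating ξ x) (hy : S.IsRotating ξ' y) (hk : 0 < k)
    (h : ∀ i j, ‖y.1 i - y.1 j‖ = k * ‖x.1 i - x.1 j‖) : IsSimilar x y := by
  have hξ : 0 < ‖ξ‖ := norm_pos_iff.2 hx.axis_ne
  have hξ' : 0 < ‖ξ'‖ := norm_pos_iff.2 hy.axis_ne
  have hn : ‖ξ'‖⁻¹ * ‖ξ'‖ = 1 := inv_mul_cancel₀ hξ'.ne'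
  obtain ⟨R, ε, hdet, hε, hR, hRn⟩ := exists_rotation_of_inner_eq
    (fun i => k • (x.1 i - x.1 0)) (fun i => y.1 i - y.1 0) (n := ‖ξ‖⁻¹ • ξ) (n' := ‖ξ'‖⁻¹ • ξ')
    (by rw [norm_smul, norm_smul, norm_inv, norm_inv, norm_norm, norm_norm, hn,
      inv_mul_cancel₀ hξ.ne'])
    (smul_ne_zero (inv_ne_zero hξ.ne') hx.axis_ne)
    (fun i => by
      rw [real_inner_smul_left, real_inner_smul_right, inner_sub_right, hx.inner_eq, hx.inner_eq]
      simp)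
    (fun i => by
      rw [real_inner_smul_left, inner_sub_right, hy.inner_eq, hy.inner_eq]
      simp)
    (fun i j => by
      rw [real_inner_smul_left, real_inner_smul_right,
        real_inner_eq_norm_mul_self_add_norm_mul_self_sub_norm_sub_mul_self_div_two,
        real_inner_eq_norm_mul_self_add_norm_mul_self_sub_norm_sub_mul_self_div_two,
        sub_sub_sub_cancel_right, sub_sub_sub_cancel_right, h, h, h]
      ring)
  have hRx : ∀ i, y.1 i = k • R (x.1 i) := by
    have h1 : ∀ i, y.1 i = k • R (x.1 i) + (y.1 0 - k • R (x.1 0)) := fun i => by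
      have := hR i
      rw [map_smul, map_sub, smul_sub] at this
      refine (eq_add_of_sub_eq this.symm).trans ?_
      abel
    -- Both centers of mass are $0$, so the remaining translation vanishes.
    have h2 : (∑ i, S.mass i) • (y.1 0 - k • R (x.1 0)) = 0 := by
      have e := S.sum_mass_smul_eq_zero hy.centerOfMass_eq
      rw [Finset.sum_congr rfl fun i _ => by rw [h1 i, smul_add, smul_comm, ← map_smul]] at e
      rw [Finset.sum_add_distrib, ← Finset.smul_sum, ← map_sum,
        S.sum_mass_smul_eq_zero hx.centerOfMass_eq, map_zero, smul_zero, zero_add,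
        ← Finset.sum_smul] at e
      exact e
    have hM : 0 < ∑ i, S.mass i := Finset.sum_pos (fun i _ => S.mass_pos i) Finset.univ_nonempty
    intro i
    rw [h1 i, (smul_eq_zero.1 h2).resolve_left hM.ne', add_zero]
  -- Kepler's third law: the gradient is homogeneous of degree $-2$ and the right side of the
  -- equation of degree $1$.
  have hscale : ‖ξ'‖ ^ 2 * k ^ 3 = ‖ξ‖ ^ 2 := by
    obtain ⟨i, hi⟩ : ∃ i, x.1 i ≠ 0 := by
      by_contra! h0
      exact hx.mem 0 1 (by decide) ((h0 0).trans (h0 1).symm)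
    have e := hy.grad_eq i
    rw [S.partialGrad_potential hy.mem, S.pairGrad_eq_of_similar R hk hRx,
      S.pairGrad_eq_of_similar R hk hRx, ← smul_add, ← map_add, ← S.partialGrad_potential hx.mem,
      hx.grad_eq, hRx, map_smul, smul_smul, smul_smul] at e
    have hRi : R (x.1 i) ≠ 0 := by rwa [Ne, map_eq_zero_iff R R.injective]
    have e' := smul_left_injective ℝ hRi e
    have := (S.mass_pos i).ne'
    field_simp at e'
    linarith
  have hε2 : ε * ε = 1 := by rcases hε with rfl | rfl <;> norm_num
  have hsqrt : 0 < √k := Real.sqrt_pos.2 hk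
  have hRξ : ξ' = (ε * (‖ξ'‖ / ‖ξ‖)) • R ξ := by
    rw [map_smul, smul_smul] at hRn
    have : R ξ = (‖ξ‖ * (ε * ‖ξ'‖⁻¹)) • ξ' := by
      rw [mul_smul, ← hRn, smul_smul, mul_inv_cancel₀ hξ.ne', one_smul]
    rw [this, smul_smul]
    have e : ε * (‖ξ'‖ / ‖ξ‖) * (‖ξ‖ * (ε * ‖ξ'‖⁻¹)) = 1 := by
      field_simp
      linarith
    rw [e, one_smul]
  have hratio : k * (‖ξ'‖ / ‖ξ‖) = (√k)⁻¹ := by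
    rw [← sq_eq_sq₀ (by positivity) (by positivity), inv_pow, Real.sq_sqrt hk.le, mul_pow, div_pow,
      ← hscale]
    field_simp
  -- $\mu^2=k$ gives the size, and a negative $\mu$ reverses time when $R$ sends $\xi$ to a negative
  -- multiple of $\xi'$.
  refine ⟨R, 0, ε * √k, hdet, ?_, fun i => ?_, fun i => ?_⟩
  · have : ε ≠ 0 := left_ne_zero_of_mul_eq_one hε2
    positivity
  · rw [add_zero, mul_pow, Real.sq_sqrt hk.le, sq ε, hε2, one_mul, hRx]
  · rw [hy.momentum_eq, hx.momentum_eq, hRx, map_smul, R.map_cross3 hdet]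
    conv_lhs => rw [hRξ]
    rw [cross3_smul_left, cross3_smul_right, smul_smul, smul_smul, smul_smul, mul_inv, ← hratio,
      inv_eq_of_mul_eq_one_left hε2]
    congr 1
    ring

/-! ### The equations of central configurations -/

/-- The coefficient of `q i - q j` in the equations of central configurations with multiplier `κ`
times the total mass. -/
noncomputable def pairWeight {N : ℕ} (S : ChargedSystem N) (κ : ℝ) (q : Config N)
    (i j : Fin N) : ℝ :=
  S.γ i j / ‖q i - q j‖ ^ 3 - κ * S.mass i * S.mass j

theorem pairWeight_symm {N : ℕ} (S : ChargedSystem N) (κ : ℝ) (q : Config N) (i j : Fin N) :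
    S.pairWeight κ q i j = S.pairWeight κ q j i := by
  rw [pairWeight, pairWeight, S.γ_symm, norm_sub_rev]
  ring

/-- The total mass. -/
noncomputable def totalMass {N : ℕ} (S : ChargedSystem N) : ℝ := ∑ i, S.mass i

theorem totalMass_pos {N : ℕ} [NeZero N] (S : ChargedSystem N) : 0 < S.totalMass :=
  Finset.sum_pos (fun i _ => S.mass_pos i) Finset.univ_nonempty

end ChargedSystem

theorem Fin.sum_univ_three_rotate {M : Type*} [AddCommMonoid M] (f : Fin 3 → M) (i : Fin 3) :
    ∑ k, f k = f i + f (i + 1) + f (i + 2) := by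
  rw [Fin.sum_univ_three]
  fin_cases i
  · rfl
  · change f 0 + f 1 + f 2 = f 1 + f 2 + f 0
    abel
  · change f 0 + f 1 + f 2 = f 2 + f 0 + f 1
    abel

theorem Fin.three_eq_or (i j : Fin 3) : i = j ∨ i = j + 1 ∨ i = j + 2 := by
  revert i j; decide

theorem Fin.three_add_one_add_one (i : Fin 3) : i + 1 + 1 = i + 2 := by revert i; decide
theorem Fin.three_add_one_add_two (i : Fin 3) : i + 1 + 2 = i := by revert i; decide
theorem Fin.three_add_two_add_one (i : Fin 3) : i + 2 + 1 = i := by revert i; decide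
theorem Fin.three_add_two_add_two (i : Fin 3) : i + 2 + 2 = i + 1 := by revert i; decide
theorem Fin.three_add_one_ne (i : Fin 3) : i + 1 ≠ i := by revert i; decide
theorem Fin.three_add_two_ne (i : Fin 3) : i + 2 ≠ i := by revert i; decide
theorem Fin.three_add_two_ne_add_one (i : Fin 3) : i + 2 ≠ i + 1 := by revert i; decide

namespace ChargedSystem

/-- With the center of mass at $0$, $Mq_i=\sum_j m_j(q_i-q_j)$, so both sides are combinations of
differences. -/
theorem partialGrad_eq_iff (S : ChargedSystem 3) {q : Config 3} (hq : q ∈ configSpace 3)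
    (hcm : ∑ i, S.mass i • q i = 0) (κ : ℝ) (i : Fin 3) :
    partialGrad S.potential q i = (S.mass i * (κ * S.totalMass)) • q i ↔
      S.pairWeight κ q i (i + 1) • (q i - q (i + 1)) +
        S.pairWeight κ q i (i + 2) • (q i - q (i + 2)) = 0 := by
  have h : (S.mass i * (κ * S.totalMass)) • q i =
      (κ * S.mass i * S.mass (i + 1)) • (q i - q (i + 1)) +
        (κ * S.mass i * S.mass (i + 2)) • (q i - q (i + 2)) := by
    rw [Fin.sum_univ_three_rotate _ i] at hcm
    rw [totalMass, Fin.sum_univ_three_rotate _ i]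
    have e : S.mass i • q i = -(S.mass (i + 1) • q (i + 1) + S.mass (i + 2) • q (i + 2)) := by
      rw [eq_neg_iff_add_eq_zero, ← add_assoc, hcm]
    have e' : (κ * S.mass i) • (S.mass i • q i) =
        (κ * S.mass i) • -(S.mass (i + 1) • q (i + 1) + S.mass (i + 2) • q (i + 2)) := by rw [e]
    rw [← sub_eq_zero] at e' ⊢
    rw [← e']
    module
  rw [S.partialGrad_potential hq, h, ← sub_eq_zero]
  have e2 : S.pairGrad q i (i + 1) + S.pairGrad q i (i + 2) -
      ((κ * S.mass i * S.mass (i + 1)) • (q i - q (i + 1)) +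
        (κ * S.mass i * S.mass (i + 2)) • (q i - q (i + 2))) =
      S.pairWeight κ q i (i + 1) • (q i - q (i + 1)) +
        S.pairWeight κ q i (i + 2) • (q i - q (i + 2)) := by
    rw [pairWeight, pairWeight, sub_smul, sub_smul, pairGrad, pairGrad]
    abel
  rw [e2]

theorem IsRotating.exists_pairWeight {S : ChargedSystem 3} {ξ : Space3} {x : Phase 3}
    (h : S.IsRotating ξ x) : ∃ κ, 0 < κ ∧ ∀ i,
      S.pairWeight κ x.1 i (i + 1) • (x.1 i - x.1 (i + 1)) +
        S.pairWeight κ x.1 i (i + 2) • (x.1 i - x.1 (i + 2)) = 0 := by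
  have hM := S.totalMass_pos
  have hξ : 0 < ‖ξ‖ := norm_pos_iff.2 h.axis_ne
  refine ⟨‖ξ‖ ^ 2 / S.totalMass, by positivity, fun i => ?_⟩
  rw [← S.partialGrad_eq_iff h.mem (S.sum_mass_smul_eq_zero h.centerOfMass_eq),
    div_mul_cancel₀ _ hM.ne', h.grad_eq]

end ChargedSystem

/-! ### Non-collinear configurations -/

theorem collinear_of_smul_add_smul_eq_zero {q : Config 3} {i : Fin 3} {a b : ℝ} (ha : a ≠ 0)
    (h : a • (q i - q (i + 1)) + b • (q i - q (i + 2)) = 0) : Collinear ℝ (Set.range q) := by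
  rw [collinear_iff_exists_forall_eq_smul_vadd]
  refine ⟨q i, q i - q (i + 2), ?_⟩
  rintro _ ⟨k, rfl⟩
  rcases Fin.three_eq_or k i with rfl | rfl | rfl
  · exact ⟨0, by simp⟩
  · refine ⟨a⁻¹ * b, ?_⟩
    rw [vadd_eq_add, ← sub_eq_iff_eq_add, mul_smul, eq_inv_smul_iff₀ ha,
      ← sub_eq_zero, ← neg_eq_zero, ← h]
    module
  · exact ⟨-1, by simp⟩

namespace ChargedSystem

/-- Independence of the differences makes each weight zero, so $r_{ij}^3=\gamma_{ij}/(\kappa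
m_im_j)$; only the scale, through $\kappa$, is free. -/
theorem isSimilar_of_not_collinear {S : ChargedSystem 3} {ξ ξ' : Space3} {x y : Phase 3}
    (hx : S.IsRotating ξ x) (hy : S.IsRotating ξ' y) (hxc : ¬ Collinear ℝ (Set.range x.1))
    (hyc : ¬ Collinear ℝ (Set.range y.1)) : IsSimilar x y := by
  have key : ∀ {η : Space3} {z : Phase 3}, S.IsRotating η z → ¬ Collinear ℝ (Set.range z.1) →
      ∃ κ, 0 < κ ∧ ∀ i, S.γ i (i + 1) = κ * (S.mass i * S.mass (i + 1)) *
        ‖z.1 i - z.1 (i + 1)‖ ^ 3 := by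
    intro η z hz hc
    obtain ⟨κ, hκ, h⟩ := hz.exists_pairWeight
    refine ⟨κ, hκ, fun i => ?_⟩
    have h0 : S.pairWeight κ z.1 i (i + 1) = 0 := by
      by_contra h0
      exact hc (collinear_of_smul_add_smul_eq_zero h0 (h i))
    have hn : ‖z.1 i - z.1 (i + 1)‖ ≠ 0 :=
      norm_ne_zero_iff.2 (sub_ne_zero.2 (hz.mem _ _ (Fin.three_add_one_ne i).symm))
    rw [pairWeight, sub_eq_zero, div_eq_iff (pow_ne_zero 3 hn)] at h0
    rw [h0]
    ring
  obtain ⟨κ, hκ, h⟩ := key hx hxc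
  obtain ⟨κ', hκ', h'⟩ := key hy hyc
  have hpos : ∀ {η : Space3} {z : Phase 3}, S.IsRotating η z → ∀ i,
      0 < ‖z.1 i - z.1 (i + 1)‖ := fun hz i =>
    norm_pos_iff.2 (sub_ne_zero.2 (hz.mem _ _ (Fin.three_add_one_ne i).symm))
  have hcube : ∀ i, κ' * ‖y.1 i - y.1 (i + 1)‖ ^ 3 = κ * ‖x.1 i - x.1 (i + 1)‖ ^ 3 := fun i => by
    have hm : S.mass i * S.mass (i + 1) ≠ 0 :=
      mul_ne_zero (S.mass_pos i).ne' (S.mass_pos (i + 1)).ne'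
    have := (h i).symm.trans (h' i)
    apply mul_left_cancel₀ hm
    linarith
  let k := ‖y.1 0 - y.1 (0 + 1)‖ / ‖x.1 0 - x.1 (0 + 1)‖
  have hk : 0 < k := div_pos (hpos hy 0) (hpos hx 0)
  have hk3 : κ' * k ^ 3 = κ := by
    have := hcube 0
    have := (hpos hx 0).ne'
    simp only [k, div_pow]
    field_simp
    linarith
  have hadj : ∀ i, ‖y.1 i - y.1 (i + 1)‖ = k * ‖x.1 i - x.1 (i + 1)‖ := fun i => by
    have h3 : ‖y.1 i - y.1 (i + 1)‖ ^ 3 = (k * ‖x.1 i - x.1 (i + 1)‖) ^ 3 := by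
      apply mul_left_cancel₀ hκ'.ne'
      rw [hcube, mul_pow, ← mul_assoc, hk3]
    exact (pow_left_inj₀ (norm_nonneg _) (by positivity) (by norm_num)).1 h3
  refine hx.isSimilar hy hk fun i j => ?_
  rcases Fin.three_eq_or j i with rfl | rfl | rfl
  · simp
  · exact hadj i
  · have := hadj (i + 2)
    rwa [Fin.three_add_two_add_one, norm_sub_rev, norm_sub_rev (x.1 (i + 2))] at this

end ChargedSystem

/-! ### Collinear configurations -/

/-- The body `p.1` lies between the other two bodies, and `p.2` is the ratio of its distances to
the bodies `p.1 + 2` and `p.1 + 1`. -/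
def HasCollinearShape (q : Config 3) (p : Fin 3 × ℝ) : Prop :=
  0 < p.2 ∧ q (p.1 + 2) - q p.1 = p.2 • (q p.1 - q (p.1 + 1))

theorem Wbtw.exists_sub_eq_smul_sub {a b c : Space3} (h : Wbtw ℝ a b c) (hab : a ≠ b)
    (hbc : b ≠ c) : ∃ r : ℝ, 0 < r ∧ c - b = r • (b - a) := by
  obtain ⟨t, ⟨ht0, ht1⟩, rfl⟩ := h
  have h0 : t ≠ 0 := by
    rintro rfl
    simp at hab
  have h1 : t ≠ 1 := by
    rintro rfl
    simp at hbc
  have h0 : 0 < t := lt_of_le_of_ne ht0 h0.symm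
  have h1 : 0 < 1 - t := sub_pos.2 (lt_of_le_of_ne ht1 h1)
  refine ⟨(1 - t) / t, by positivity, ?_⟩
  have e1 : AffineMap.lineMap a c t - a = t • (c - a) := by
    rw [AffineMap.lineMap_apply]
    simp
  have e2 : c - AffineMap.lineMap a c t = (1 - t) • (c - a) := by
    rw [AffineMap.lineMap_apply, vsub_eq_sub, vadd_eq_add]
    module
  rw [e1, e2, smul_smul, div_mul_cancel₀ _ h0.ne']

theorem exists_hasCollinearShape {q : Config 3} (hq : q ∈ configSpace 3)
    (hc : Collinear ℝ (Set.range q)) : ∃ p, HasCollinearShape q p := by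
  have key : ∀ j : Fin 3, Wbtw ℝ (q (j + 1)) (q j) (q (j + 2)) → ∃ p, HasCollinearShape q p := by
    intro j h
    obtain ⟨r, hr, hr'⟩ := h.exists_sub_eq_smul_sub (hq _ _ (Fin.three_add_one_ne j))
      (hq _ _ (Fin.three_add_two_ne j).symm)
    exact ⟨(j, r), hr, hr'⟩
  have hrange : Set.range q = {q 0, q 1, q 2} := by
    ext v
    simp only [Set.mem_range, Set.mem_insert_iff, Set.mem_singleton_iff]
    constructor
    · rintro ⟨k, rfl⟩
      fin_cases k <;> simp
    · rintro (rfl | rfl | rfl) <;> exact ⟨_, rfl⟩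
  rw [hrange] at hc
  rcases hc.wbtw_or_wbtw_or_wbtw with h | h | h
  · exact key 1 h.symm
  · exact key 2 h.symm
  · exact key 0 h.symm

namespace HasCollinearShape

variable {q q' : Config 3} {p p' : Fin 3 × ℝ}

/-- Coordinates on the line of a collinear configuration with given shape. -/
noncomputable def coord (p : Fin 3 × ℝ) (i : Fin 3) : ℝ :=
  if i = p.1 then 1 else if i = p.1 + 1 then 0 else 1 + p.2

@[simp]
theorem coord_self (p : Fin 3 × ℝ) : coord p p.1 = 1 := if_pos rfl

@[simp]
theorem coord_add_one (p : Fin 3 × ℝ) : coord p (p.1 + 1) = 0 := by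
  rw [coord, if_neg (Fin.three_add_one_ne _), if_pos rfl]

@[simp]
theorem coord_add_two (p : Fin 3 × ℝ) : coord p (p.1 + 2) = 1 + p.2 := by
  rw [coord, if_neg (Fin.three_add_two_ne _), if_neg (Fin.three_add_two_ne_add_one _)]

theorem sub_eq (h : HasCollinearShape q p) (i k : Fin 3) :
    q i - q k = (coord p i - coord p k) • (q p.1 - q (p.1 + 1)) := by
  have key : ∀ i, q i = coord p i • (q p.1 - q (p.1 + 1)) + q (p.1 + 1) := by
    intro i
    rcases Fin.three_eq_or i p.1 with rfl | rfl | rfl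
    · rw [coord_self]; simp
    · rw [coord_add_one]; simp
    · rw [coord_add_two, add_smul, one_smul, ← h.2]
      abel
  rw [key i, key k, sub_smul]
  abel

theorem collinear (h : HasCollinearShape q p) : Collinear ℝ (Set.range q) := by
  rw [collinear_iff_exists_forall_eq_smul_vadd]
  refine ⟨q (p.1 + 1), q p.1 - q (p.1 + 1), ?_⟩
  rintro _ ⟨k, rfl⟩
  exact ⟨coord p k - coord p (p.1 + 1), by rw [← h.sub_eq, vadd_eq_add, sub_add_cancel]⟩

theorem sbtw (h : HasCollinearShape q p) (hq : q ∈ configSpace 3) :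
    Sbtw ℝ (q (p.1 + 1)) (q p.1) (q (p.1 + 2)) := by
  have hρ := h.1
  refine ⟨⟨(1 + p.2)⁻¹, ⟨by positivity, inv_le_one_of_one_le₀ (by linarith)⟩, ?_⟩,
    hq _ _ (Fin.three_add_one_ne _).symm, hq _ _ (Fin.three_add_two_ne _).symm⟩
  have e : q (p.1 + 2) - q (p.1 + 1) = (1 + p.2) • (q p.1 - q (p.1 + 1)) := by
    rw [h.sub_eq, coord_add_two, coord_add_one, sub_zero]
  rw [AffineMap.lineMap_apply, vsub_eq_sub, e, smul_smul, inv_mul_cancel₀ (by positivity), one_smul,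
    vadd_eq_add, sub_add_cancel]

/-- In the coordinates of the first shape, a different middle body would equate a positive number
with a negative one. -/
theorem unique (h : HasCollinearShape q p) (h' : HasCollinearShape q p') (hq : q ∈ configSpace 3) :
    p = p' := by
  have hρ := h.1
  have hρ' := h'.1
  have he : q p.1 - q (p.1 + 1) ≠ 0 := sub_ne_zero.2 (hq _ _ (Fin.three_add_one_ne _).symm)
  have e := h'.2
  rw [h.sub_eq (p'.1 + 2) p'.1, h.sub_eq p'.1 (p'.1 + 1), smul_smul] at e
  have e := smul_left_injective ℝ he e
  rcases Fin.three_eq_or p'.1 p.1 with h1 | h1 | h1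
  · refine Prod.ext h1.symm ?_
    rw [h1, coord_self, coord_add_two, coord_add_one] at e
    linarith
  · rw [h1, Fin.three_add_one_add_one, Fin.three_add_one_add_two, coord_self, coord_add_two,
      coord_add_one] at e
    nlinarith [mul_pos hρ hρ']
  · rw [h1, Fin.three_add_two_add_one, Fin.three_add_two_add_two, coord_self, coord_add_two,
      coord_add_one] at e
    nlinarith [mul_pos hρ hρ']

theorem exists_norm_sub_eq (h : HasCollinearShape q p) (h' : HasCollinearShape q' p)
    (hq : q ∈ configSpace 3) (hq' : q' ∈ configSpace 3) :
    ∃ k : ℝ, 0 < k ∧ ∀ i j, ‖q' i - q' j‖ = k * ‖q i - q j‖ := by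
  have he : 0 < ‖q p.1 - q (p.1 + 1)‖ :=
    norm_pos_iff.2 (sub_ne_zero.2 (hq _ _ (Fin.three_add_one_ne _).symm))
  have he' : 0 < ‖q' p.1 - q' (p.1 + 1)‖ :=
    norm_pos_iff.2 (sub_ne_zero.2 (hq' _ _ (Fin.three_add_one_ne _).symm))
  refine ⟨‖q' p.1 - q' (p.1 + 1)‖ / ‖q p.1 - q (p.1 + 1)‖, div_pos he' he, fun i j => ?_⟩
  rw [h.sub_eq i, h'.sub_eq i, norm_smul, norm_smul]
  field_simp

end HasCollinearShape

theorem IsSimilar.hasCollinearShape {x y : Phase 3} {p : Fin 3 × ℝ} (h : IsSimilar x y)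
    (hx : HasCollinearShape x.1 p) : HasCollinearShape y.1 p := by
  obtain ⟨R, a, μ, -, -, hR, -⟩ := h
  refine ⟨hx.1, ?_⟩
  simp only [hR, add_sub_add_right_eq_sub, ← smul_sub, ← map_sub]
  rw [hx.2, map_smul, smul_comm]

namespace ChargedSystem

/-- The shapes of the collinear central configurations with positive multiplier. -/
def collinearShapes (S : ChargedSystem 3) : Set (Fin 3 × ℝ) :=
  {p | IsCollinearShape (S.mass (p.1 + 1)) (S.mass p.1) (S.mass (p.1 + 2)) (S.γ p.1 (p.1 + 1))
    (S.γ p.1 (p.1 + 2)) (S.γ (p.1 + 1) (p.1 + 2)) p.2}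

theorem IsRotating.mem_collinearShapes {S : ChargedSystem 3} {ξ : Space3} {x : Phase 3}
    {p : Fin 3 × ℝ} (h : S.IsRotating ξ x) (hp : HasCollinearShape x.1 p) :
    p ∈ S.collinearShapes := by
  obtain ⟨κ, hκ, hw⟩ := h.exists_pairWeight
  obtain ⟨j, ρ⟩ := p
  have hρ : 0 < ρ := hp.1
  have he0 : x.1 j - x.1 (j + 1) ≠ 0 := sub_ne_zero.2 (h.mem _ _ (Fin.three_add_one_ne _).symm)
  have hd : 0 < ‖x.1 j - x.1 (j + 1)‖ := norm_pos_iff.2 he0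
  set d := ‖x.1 j - x.1 (j + 1)‖ with hd_def
  have hs := hp.sub_eq
  have s1 := HasCollinearShape.coord_self (j, ρ)
  have s2 := HasCollinearShape.coord_add_one (j, ρ)
  have s3 := HasCollinearShape.coord_add_two (j, ρ)
  simp only at hs s1 s2 s3
  have n1 : ‖x.1 j - x.1 (j + 2)‖ = ρ * d := by
    rw [hs, norm_smul, s1, s3, ← hd_def]
    simp [abs_of_pos hρ]
  have n2 : ‖x.1 (j + 1) - x.1 (j + 2)‖ = (1 + ρ) * d := by
    rw [hs, norm_smul, s2, s3, ← hd_def, zero_sub, norm_neg, Real.norm_of_nonneg (by positivity)]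
  have w1 := hw j
  have w2 := hw (j + 1)
  rw [Fin.three_add_one_add_one, Fin.three_add_one_add_two, hs (j + 1) (j + 2), hs (j + 1) j,
    smul_smul, smul_smul, ← add_smul, s1, s2, s3] at w2
  rw [hs j (j + 1), hs j (j + 2), smul_smul, smul_smul, ← add_smul, s1, s2, s3] at w1
  have w1 := (smul_eq_zero.1 w1).resolve_right he0
  have w2 := (smul_eq_zero.1 w2).resolve_right he0
  rw [S.pairWeight_symm _ _ (j + 1) j] at w2
  have g1 : S.γ j (j + 1) = (S.pairWeight κ x.1 j (j + 1) + κ * S.mass j * S.mass (j + 1)) *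
      d ^ 3 := by
    rw [pairWeight, sub_add_cancel, div_mul_cancel₀ _ (by positivity)]
  have g2 : S.γ j (j + 2) = (S.pairWeight κ x.1 j (j + 2) + κ * S.mass j * S.mass (j + 2)) *
      (ρ * d) ^ 3 := by
    rw [pairWeight, sub_add_cancel, n1, div_mul_cancel₀ _ (by positivity)]
  have g3 : S.γ (j + 1) (j + 2) = (S.pairWeight κ x.1 (j + 1) (j + 2) +
      κ * S.mass (j + 1) * S.mass (j + 2)) * ((1 + ρ) * d) ^ 3 := by
    rw [pairWeight, sub_add_cancel, n2, div_mul_cancel₀ _ (by positivity)]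
  -- The factor $d^3$ normalizes the first gap to length $1$. The equations of two bodies express
  -- the other two weights through this one.
  refine ⟨hρ, κ * d ^ 3, S.pairWeight κ x.1 j (j + 1) * d ^ 3, by positivity, ?_, ?_, ?_⟩
  · rw [g1]; ring
  · rw [g2]; linear_combination (-d ^ 3 * ρ ^ 2) * w1
  · rw [g3]; linear_combination (-d ^ 3 * (1 + ρ) ^ 2) * w2

theorem exists_isRotating_of_mem_collinearShapes {S : ChargedSystem 3} {p : Fin 3 × ℝ}
    (hp : p ∈ S.collinearShapes) : ∃ x ξ, S.IsRotating ξ x ∧ HasCollinearShape x.1 p := by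
  obtain ⟨j, ρ⟩ := p
  obtain ⟨hρ, κ, τ, hκ, h1, h2, h3⟩ := hp
  simp only at hρ h1 h2 h3
  have hM := S.totalMass_pos
  have s1 := HasCollinearShape.coord_self (j, ρ)
  have s2 := HasCollinearShape.coord_add_one (j, ρ)
  have s3 := HasCollinearShape.coord_add_two (j, ρ)
  simp only at s1 s2 s3
  let s := HasCollinearShape.coord (j, ρ)
  let e : Space3 := EuclideanSpace.single 0 1
  let f : Space3 := EuclideanSpace.single 2 1
  have hne : ‖e‖ = 1 := by simp [e]
  have hnf : ‖f‖ = 1 := by simp [f]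
  have hef : ⟪f, e⟫ = 0 := by simp [e, f, inner_eq_sum_three]
  let mean := (∑ i, S.mass i * s i) / S.totalMass
  let q : Config 3 := fun i => (s i - mean) • e
  -- The configuration lies on the first axis and rotates about the third; the length is chosen so
  -- that $|\xi|^2=\kappa M$, the required multiplier.
  let ξ : Space3 := √(κ * S.totalMass) • f
  have hsub : ∀ i k, q i - q k = (s i - s k) • e := fun i k => by
    simp only [q, ← sub_smul]
    congr 1
    ring
  have hnorm : ∀ i k, ‖q i - q k‖ = |s i - s k| := fun i k => by
    rw [hsub, norm_smul, hne, mul_one, Real.norm_eq_abs]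
  have hq : q ∈ configSpace 3 := by
    intro i k hik heq
    have : ‖q i - q k‖ = 0 := by rw [heq, sub_self, norm_zero]
    rw [hnorm, abs_eq_zero] at this
    rcases Fin.three_eq_or i j with hi | hi | hi <;>
    rcases Fin.three_eq_or k j with hk | hk | hk <;> rw [hi, hk] at this hik <;>
      first
      | exact hik rfl
      | (simp only [s, s1, s2, s3] at this; linarith)
  have hsum : ∑ i, S.mass i • q i = 0 := by
    simp only [q, smul_smul, ← Finset.sum_smul]
    have : ∑ i, S.mass i * (s i - mean) = 0 := by
      simp only [mul_sub, Finset.sum_sub_distrib, ← Finset.sum_mul]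
      change _ - S.totalMass * mean = 0
      rw [mul_div_cancel₀ _ hM.ne', sub_self]
    rw [this, zero_smul]
  have hshape : HasCollinearShape q (j, ρ) := by
    refine ⟨hρ, ?_⟩
    simp only [hsub, s, s1, s2, s3, smul_smul]
    congr 1
    ring
  have habs : |-ρ| = ρ := by rw [abs_neg, abs_of_pos hρ]
  have w1 : S.pairWeight κ q j (j + 1) = τ := by
    rw [pairWeight, hnorm, h1]
    simp only [s, s1, s2]
    norm_num
    ring
  have w2 : S.pairWeight κ q j (j + 2) = τ / ρ := by
    rw [pairWeight, hnorm, h2]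
    simp only [s, s1, s3]
    rw [show (1 - (1 + ρ) : ℝ) = -ρ by ring, habs]
    field_simp
    ring
  have w3 : S.pairWeight κ q (j + 1) (j + 2) = -τ / (1 + ρ) := by
    rw [pairWeight, hnorm, h3]
    simp only [s, s2, s3]
    rw [zero_sub, abs_neg, abs_of_pos (by positivity)]
    field_simp
    ring
  have hnξ : ‖ξ‖ ^ 2 = κ * S.totalMass := by
    rw [norm_smul, hnf, mul_one, Real.norm_eq_abs, sq_abs, Real.sq_sqrt (by positivity)]
  refine ⟨(q, fun i => S.mass i • cross3 ξ (q i)), ξ, ⟨hq, ?_, ?_, ?_, fun i => rfl, ?_⟩, hshape⟩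
  · rw [centerOfMass, hsum, smul_zero]
  · rw [← norm_ne_zero_iff]
    intro h0
    rw [h0] at hnξ
    have : 0 < κ * S.totalMass := by positivity
    linarith
  · intro i
    simp only [q, ξ, real_inner_smul_left, real_inner_smul_right, hef, mul_zero]
  · intro i
    simp only
    rw [hnξ, S.partialGrad_eq_iff hq hsum]
    rcases Fin.three_eq_or i j with rfl | rfl | rfl
    · rw [w1, w2, hsub, hsub, smul_smul, smul_smul, ← add_smul]
      simp only [s, s1, s2, s3]
      convert zero_smul ℝ e using 2
      field_simp
      ring
    · rw [Fin.three_add_one_add_one, Fin.three_add_one_add_two, S.pairWeight_symm _ _ (j + 1) j, w1,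
        w3, hsub, hsub, smul_smul, smul_smul, ← add_smul]
      simp only [s, s1, s2, s3]
      convert zero_smul ℝ e using 2
      field_simp
      ring
    · rw [Fin.three_add_two_add_one, Fin.three_add_two_add_two, S.pairWeight_symm _ _ (j + 2) j,
        S.pairWeight_symm _ _ (j + 2) (j + 1), w2,
        w3, hsub, hsub, smul_smul, smul_smul, ← add_smul]
      simp only [s, s1, s2, s3]
      convert zero_smul ℝ e using 2
      field_simp
      ring

end ChargedSystem

/-! ### Counting up to similarity -/

/-- Used in both directions between similarity classes and shapes, so that neither map has to be
constructed explicitly. -/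
theorem Set.encard_le_encard_of_rel {α β : Type*} {s : Set α} {t : Set β} (r : α → β → Prop)
    (h : ∀ a ∈ s, ∃ b ∈ t, r a b) (hr : ∀ a ∈ s, ∀ a' ∈ s, ∀ b, r a b → r a' b → a = a') :
    s.encard ≤ t.encard := by
  rcases s.eq_empty_or_nonempty with rfl | ⟨a₀, ha₀⟩
  · simp
  have : Nonempty β := ⟨(h a₀ ha₀).choose⟩
  choose! f hf hrf using h
  refine Set.encard_le_encard_of_injOn hf fun a ha a' ha' haa' => ?_
  exact hr a ha a' ha' (f a) (hrf a ha) (haa' ▸ hrf a' ha')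

namespace ChargedSystem

theorem numUpToSimilarity_nonCollinearCriticalPoints_le (S : ChargedSystem 3) :
    numUpToSimilarity S.nonCollinearCriticalPoints ≤ 1 := by
  rw [numUpToSimilarity, Set.encard_le_one_iff]
  rintro _ _ ⟨x, ⟨hx1, hx2, hx3, hx4⟩, rfl⟩ ⟨y, ⟨hy1, hy2, hy3, hy4⟩, rfl⟩
  obtain ⟨ξ, hx⟩ := S.exists_isRotating hx1.2.2.1 hx2 hx3
  obtain ⟨η, hy⟩ := S.exists_isRotating hy1.2.2.1 hy2 hy3
  exact Quotient.sound (isSimilar_of_not_collinear hx hy hx4 hy4)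

theorem exists_mem_collinearShapes {S : ChargedSystem 3} {x : Phase 3}
    (hx : x ∈ S.collinearCriticalPoints) : ∃ p ∈ S.collinearShapes, HasCollinearShape x.1 p := by
  obtain ⟨⟨ξ, h⟩, hc⟩ := mem_collinearCriticalPoints_iff.1 hx
  obtain ⟨p, hp⟩ := exists_hasCollinearShape h.mem hc
  exact ⟨p, h.mem_collinearShapes hp, hp⟩

theorem isSimilar_of_hasCollinearShape {S : ChargedSystem 3} {x y : Phase 3} {p : Fin 3 × ℝ}
    (hx : x ∈ S.collinearCriticalPoints) (hy : y ∈ S.collinearCriticalPoints)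
    (hxp : HasCollinearShape x.1 p) (hyp : HasCollinearShape y.1 p) : IsSimilar x y := by
  obtain ⟨⟨ξ, hx⟩, -⟩ := mem_collinearCriticalPoints_iff.1 hx
  obtain ⟨⟨η, hy⟩, -⟩ := mem_collinearCriticalPoints_iff.1 hy
  obtain ⟨k, hk, h⟩ := hxp.exists_norm_sub_eq hyp hx.mem hy.mem
  exact hx.isSimilar hy hk h

theorem numUpToSimilarity_collinearCriticalPoints (S : ChargedSystem 3) :
    numUpToSimilarity S.collinearCriticalPoints = S.collinearShapes.encard := by
  let r : Quotient (similarity 3) → Fin 3 × ℝ → Prop := fun c p =>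
    ∃ x ∈ S.collinearCriticalPoints, Quotient.mk (similarity 3) x = c ∧ HasCollinearShape x.1 p
  apply le_antisymm
  · refine Set.encard_le_encard_of_rel r ?_ ?_
    · rintro _ ⟨x, hx, rfl⟩
      obtain ⟨p, hp, hxp⟩ := exists_mem_collinearShapes hx
      exact ⟨p, hp, x, hx, rfl, hxp⟩
    · rintro _ - _ - p ⟨x, hx, rfl, hxp⟩ ⟨y, hy, rfl, hyp⟩
      exact Quotient.sound (isSimilar_of_hasCollinearShape hx hy hxp hyp)
  · refine Set.encard_le_encard_of_rel (fun p c => r c p) ?_ ?_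
    · intro p hp
      obtain ⟨x, ξ, hx, hxp⟩ := exists_isRotating_of_mem_collinearShapes hp
      have hxc : x ∈ S.collinearCriticalPoints :=
        mem_collinearCriticalPoints_iff.2 ⟨⟨ξ, hx⟩, hxp.collinear⟩
      exact ⟨_, ⟨x, hxc, rfl⟩, x, hxc, rfl, hxp⟩
    · rintro p - p' - _ ⟨x, hx, rfl, hxp⟩ ⟨y, hy, hxy, hyp⟩
      have hsim : IsSimilar y x := Quotient.exact hxy
      exact hxp.unique (hsim.hasCollinearShape hyp) hx.1.1

theorem collinearShapes_eq_union (S : ChargedSystem 3) :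
    S.collinearShapes = Prod.mk 0 '' {ρ | ((0 : Fin 3), ρ) ∈ S.collinearShapes} ∪
      Prod.mk 1 '' {ρ | ((1 : Fin 3), ρ) ∈ S.collinearShapes} ∪
      Prod.mk 2 '' {ρ | ((2 : Fin 3), ρ) ∈ S.collinearShapes} := by
  ext ⟨j, ρ⟩
  fin_cases j <;> simp

theorem encard_collinearShapes_le (S : ChargedSystem 3) : S.collinearShapes.encard ≤ 3 := by
  rw [S.collinearShapes_eq_union]
  refine (Set.encard_union_le _ _).trans ((add_le_add_left (Set.encard_union_le _ _) _).trans ?_)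
  simp only [(Prod.mk_right_injective _).encard_image]
  -- These arguments put body $0$ in the middle; the other two orders are the cyclic shifts.
  have h := encard_collinearShape_sum_le (A := S.γ 0 1) (B := S.γ 0 2) (C := S.γ 1 2)
    (S.mass_pos 1) (S.mass_pos 0) (S.mass_pos 2)
  have e10 : S.γ 0 1 = S.γ 1 0 := S.γ_symm 0 1
  have e20 : S.γ 0 2 = S.γ 2 0 := S.γ_symm 0 2
  have e21 : S.γ 1 2 = S.γ 2 1 := S.γ_symm 1 2
  have e0 : {ρ | ((0 : Fin 3), ρ) ∈ S.collinearShapes} = {ρ | IsCollinearShape (S.mass 1) (S.mass 0)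
      (S.mass 2) (S.γ 0 1) (S.γ 0 2) (S.γ 1 2) ρ} := rfl
  have e1 : {ρ | ((1 : Fin 3), ρ) ∈ S.collinearShapes} = {ρ | IsCollinearShape (S.mass 2) (S.mass 1)
      (S.mass 0) (S.γ 1 2) (S.γ 0 1) (S.γ 0 2) ρ} := by
    rw [e10, e20]; rfl
  have e2 : {ρ | ((2 : Fin 3), ρ) ∈ S.collinearShapes} = {ρ | IsCollinearShape (S.mass 0) (S.mass 2)
      (S.mass 1) (S.γ 0 2) (S.γ 1 2) (S.γ 0 1) ρ} := by
    rw [e21, e20]; rfl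
  rw [e0, e1, e2]
  exact h

/-! ### Examples -/

/-- With body $0$ or $1$ in the middle, the outer coefficient and one adjacent coefficient would be
nonpositive. -/
theorem fst_eq_two_of_mem_collinearShapes {S : ChargedSystem 3} (h02 : S.γ 0 2 ≤ 0)
    (h12 : S.γ 1 2 ≤ 0) {p : Fin 3 × ℝ} (hp : p ∈ S.collinearShapes) : p.1 = 2 := by
  obtain ⟨j, ρ⟩ := p
  fin_cases j
  · exact (not_isCollinearShape (S.mass_pos 1) (S.mass_pos 0) (S.mass_pos 2) h12 (Or.inr h02) ρ
      hp).elim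
  · rw [S.γ_symm] at h02
    exact (not_isCollinearShape (S.mass_pos 2) (S.mass_pos 1) (S.mass_pos 0) h02 (Or.inl h12) ρ
      hp).elim
  · rfl

theorem sbtw_of_mem_collinearCriticalPoints {S : ChargedSystem 3} (h02 : S.γ 0 2 ≤ 0)
    (h12 : S.γ 1 2 ≤ 0) {x : Phase 3} (hx : x ∈ S.collinearCriticalPoints) :
    Sbtw ℝ (x.1 0) (x.1 2) (x.1 1) := by
  obtain ⟨⟨j, ρ⟩, hp, hxp⟩ := exists_mem_collinearShapes hx
  obtain rfl : j = 2 := fst_eq_two_of_mem_collinearShapes h02 h12 hp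
  exact hxp.sbtw hx.1.1

theorem encard_collinearShapes_of_nonpos {S : ChargedSystem 3} (h02 : S.γ 0 2 ≤ 0)
    (h12 : S.γ 1 2 ≤ 0) : S.collinearShapes.encard =
      {ρ | IsCollinearShape (S.mass 0) (S.mass 2) (S.mass 1) (S.γ 0 2) (S.γ 1 2) (S.γ 0 1)
        ρ}.encard := by
  rw [← (Prod.mk_right_injective (2 : Fin 3)).encard_image {ρ | IsCollinearShape _ _ _ _ _ _ ρ}]
  have e : ∀ ρ, ((2 : Fin 3), ρ) ∈ S.collinearShapes ↔ IsCollinearShape (S.mass 0) (S.mass 2)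
      (S.mass 1) (S.γ 0 2) (S.γ 1 2) (S.γ 0 1) ρ := fun ρ => by
    rw [S.γ_symm 0 2, S.γ_symm 1 2]; rfl
  refine congrArg Set.encard (Set.ext fun ⟨j, ρ⟩ => ?_)
  constructor
  · intro hp
    obtain rfl : j = 2 := fst_eq_two_of_mem_collinearShapes h02 h12 hp
    exact ⟨ρ, (e ρ).1 hp, rfl⟩
  · rintro ⟨ρ', h, hρ⟩
    rw [← hρ]
    exact (e ρ').2 h

/-- A charged three-body system with explicit parameters. -/
def ofParameters (a b c A B C : ℝ) (ha : 0 < a) (hb : 0 < b) (hc : 0 < c) : ChargedSystem 3 where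
  -- Body $2$ is the middle one, so `b` comes last.
  mass := ![a, c, b]
  mass_pos i := by fin_cases i <;> assumption
  γ := ![![0, C, A], ![C, 0, B], ![A, B, 0]]
  γ_symm i j := by fin_cases i <;> fin_cases j <;> rfl

theorem exists_of_encard_eq {a b c A B C : ℝ} (ha : 0 < a) (hb : 0 < b) (hc : 0 < c) (hA : A ≤ 0)
    (hB : B ≤ 0) {k : ℕ} (h : {ρ | IsCollinearShape a b c A B C ρ}.encard = k) :
    ∃ S : ChargedSystem 3, numUpToSimilarity S.collinearCriticalPoints = k ∧
      ∀ x ∈ S.collinearCriticalPoints, Sbtw ℝ (x.1 0) (x.1 2) (x.1 1) := by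
  refine ⟨ofParameters a b c A B C ha hb hc, ?_, fun x hx =>
    sbtw_of_mem_collinearCriticalPoints hA hB hx⟩
  rw [numUpToSimilarity_collinearCriticalPoints, ← h]
  exact encard_collinearShapes_of_nonpos hA hB

end ChargedSystem

theorem collinearShape_eq_empty : {ρ | IsCollinearShape 1 1 1 (-1) (-1) (-1) ρ} = ∅ :=
  Set.eq_empty_iff_forall_notMem.2 (not_isCollinearShape one_pos one_pos one_pos (by norm_num)
    (by norm_num))

theorem collinearShape_eq_singleton : {ρ | IsCollinearShape 1 1 1 (-1) (-1) 10 ρ} = {1} := by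
  ext ρ
  constructor
  · intro h
    obtain ⟨hρ, h⟩ := IsCollinearShape.mem_quinticPosZeros h
    have hρ : 0 < ρ := hρ
    -- For unit masses and $A=B=-1$ the quintic is
    -- $-(\rho-1)(2\rho^4+7\rho^3+(10-C)\rho^2+7\rho+2)$; $C=10$ removes the only term that could be
    -- negative.
    have e : (ρ - 1) * (2 * ρ ^ 4 + 7 * ρ ^ 3 + 7 * ρ + 2) = 0 := by
      simp only [quintic] at h
      linear_combination -h
    have hpos : 0 < 2 * ρ ^ 4 + 7 * ρ ^ 3 + 7 * ρ + 2 := by positivity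
    exact sub_eq_zero.1 ((mul_eq_zero.1 e).resolve_right hpos.ne')
  · rintro rfl
    -- A zero of the quintic need not have $\kappa>0$, so $\kappa$ and $\tau$ are exhibited; they
    -- solve the linear equations for $A$ and $C$.
    exact ⟨one_pos, 1 / 2, -3 / 2, by norm_num, by norm_num, by norm_num, by norm_num⟩

theorem collinearShape_eq_pair : {ρ | IsCollinearShape 5 1 1 0 (-1) 15 ρ} = {1, 2} := by
  ext ρ
  constructor
  · intro h
    obtain ⟨hρ, h⟩ := IsCollinearShape.mem_quinticPosZeros h
    have hρ : 0 < ρ := hρ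
    -- The choice $A=0$ kills the two leading coefficients and leaves a cubic with two positive
    -- zeros.
    have e : (ρ - 1) * (ρ - 2) * (4 * ρ + 1) = 0 := by
      simp only [quintic] at h
      linear_combination h / 5
    have hpos : 0 < 4 * ρ + 1 := by positivity
    rcases mul_eq_zero.1 ((mul_eq_zero.1 e).resolve_right hpos.ne') with h | h
    · exact Or.inl (sub_eq_zero.1 h)
    · exact Or.inr (sub_eq_zero.1 h)
  · rintro (rfl | rfl)
    · exact ⟨one_pos, 1 / 4, -5 / 4, by norm_num, by norm_num, by norm_num, by norm_num⟩
    · exact ⟨two_pos, 1 / 12, -5 / 12, by norm_num, by norm_num, by norm_num, by norm_num⟩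

theorem collinearShape_eq_triple :
    {ρ | IsCollinearShape 1 1 1 (-1) (-1) 36 ρ} = {1 / 2, 1, 2} := by
  ext ρ
  constructor
  · intro h
    obtain ⟨hρ, h⟩ := IsCollinearShape.mem_quinticPosZeros h
    have hρ : 0 < ρ := hρ
    -- In $u=\rho+1/\rho$ the palindromic quartic factor becomes $2u^2+7u+6-C$, and $C=36$ gives the
    -- root $u=5/2$, that is $\rho=2$ or $\rho=1/2$.
    have e : (ρ - 1 / 2) * ((ρ - 1) * (ρ - 2)) * (ρ ^ 2 + 6 * ρ + 1) = 0 := by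
      simp only [quintic] at h
      linear_combination -h / 2
    have hpos : 0 < ρ ^ 2 + 6 * ρ + 1 := by positivity
    rcases mul_eq_zero.1 ((mul_eq_zero.1 e).resolve_right hpos.ne') with h | h
    · exact Or.inl (sub_eq_zero.1 h)
    · rcases mul_eq_zero.1 h with h | h
      · exact Or.inr (Or.inl (sub_eq_zero.1 h))
      · exact Or.inr (Or.inr (sub_eq_zero.1 h))
  · rintro (rfl | rfl | rfl)
    · exact ⟨by norm_num, 6, -7, by norm_num, by norm_num, by norm_num, by norm_num⟩
    · exact ⟨one_pos, 8 / 3, -11 / 3, by norm_num, by norm_num, by norm_num, by norm_num⟩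
    · exact ⟨two_pos, 3 / 4, -7 / 4, by norm_num, by norm_num, by norm_num, by norm_num⟩

theorem theorem1 :
    (∀ S : ChargedSystem 3,
      numUpToSimilarity S.collinearCriticalPoints ≤ 3 ∧
      numUpToSimilarity S.nonCollinearCriticalPoints ≤ 1) ∧
    (∀ k : ℕ, k ≤ 3 → ∃ S : ChargedSystem 3,
      numUpToSimilarity S.collinearCriticalPoints = k ∧
      ∀ x ∈ S.collinearCriticalPoints, Sbtw ℝ (x.1 0) (x.1 2) (x.1 1)) := by
  refine ⟨fun S => ⟨?_, S.numUpToSimilarity_nonCollinearCriticalPoints_le⟩, fun k hk => ?_⟩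
  · rw [S.numUpToSimilarity_collinearCriticalPoints]
    exact S.encard_collinearShapes_le
  · interval_cases k
    · refine ChargedSystem.exists_of_encard_eq (A := -1) (B := -1) (C := -1) one_pos one_pos
        one_pos (by norm_num) (by norm_num) ?_
      rw [collinearShape_eq_empty]
      simp
    · refine ChargedSystem.exists_of_encard_eq (A := -1) (B := -1) (C := 10) one_pos one_pos
        one_pos (by norm_num) (by norm_num) ?_
      rw [collinearShape_eq_singleton]
      simp
    · refine ChargedSystem.exists_of_encard_eq (a := 5) (A := 0) (B := -1) (C := 15) (by norm_num)
        one_pos one_pos le_rfl (by norm_num) ?_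
      rw [collinearShape_eq_pair, Set.encard_pair (by norm_num)]
      rfl
    · refine ChargedSystem.exists_of_encard_eq (A := -1) (B := -1) (C := 36) one_pos one_pos
        one_pos (by norm_num) (by norm_num) ?_
      rw [collinearShape_eq_triple, Set.encard_insert_of_notMem (by norm_num),
        Set.encard_pair (by norm_num)]
      rfl
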